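/- Let $H_n^s$ denote $n$-dimensional singular homology with integer coefficients. For topological spaces $X$ and $Y$, a bijection $f\colon X\to Y$ (not assumed continuous) is called a hereditary equivalence with respect to $H_n^s$ if there are group isomorphisms $f_*(M)\colon H_n^s(M)\to H_n^s(f(M))$, one for every subspace $M\subset X$, such that for all $N\subset M\subset X$ one has $f_*(M)\circ i_*=j_*\circ f_*(N)$, where $i_*\colon H_n^s(N)\to H_n^s(M)$ and $j_*\colon H_n^s(f(N))\to H_n^s(f(M))$ are induced by the inclusions. A finite polyhedron is a space homeomorphic to the underlying space of a finite simplicial complex in a Euclidean space. Theorem. Let $n\ge 1$, let $X$ and $Y$ be finite polyhedra, and suppose that every point of $X$ belongs to a subspace of $X$ which is homeomorphic to the standard simplex of dimension $n+1$. Then every hereditary equivalence $f\colon X\to Y$ with respect to $H_n^s$ is a homeomorphism. -/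

import Mathlib

open CategoryTheory

universe u v

/-- The inclusion map between two subspaces `N ⊆ M` of a topological space. -/
def subspaceInclusion {X : Type u} [TopologicalSpace X] {N M : Set X} (h : N ⊆ M) :
    TopCat.of N ⟶ TopCat.of M :=
  TopCat.ofHom ⟨Set.inclusion h, continuous_inclusion h⟩

/-- A map `f : X → Y` is a hereditary equivalence with respect to a covariant functor `F` with
values in abelian groups if it is a bijection (not assumed continuous) and there are isomorphisms
`F M ≅ F (f M)`, for all subspaces `M` of `X`, which commute with the homomorphisms induced by the
inclusions of subspaces. -/
def IsHereditaryEquivalence (F : TopCat.{u} ⥤ AddCommGrpCat.{v}) {X Y : Type u}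
    [TopologicalSpace X] [TopologicalSpace Y] (f : X → Y) : Prop :=
  Function.Bijective f ∧
    ∃ φ : ∀ M : Set X, F.obj (TopCat.of M) ≅ F.obj (TopCat.of (f '' M)),
      ∀ (N M : Set X) (h : N ⊆ M),
        F.map (subspaceInclusion h) ≫ (φ M).hom =
          (φ N).hom ≫ F.map (subspaceInclusion (Set.image_mono (f := f) h))

/-- The functor of `n`-dimensional singular homology with integer coefficients. -/
noncomputable def singularHomologyInt (n : ℕ) : TopCat.{u} ⥤ AddCommGrpCat.{u} :=
  (AlgebraicTopology.singularHomologyFunctor AddCommGrpCat.{u} n).obj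
    (AddCommGrpCat.of (ULift.{u} ℤ))

/-- A finite polyhedron is a space homeomorphic to the underlying space of a finite (geometric)
simplicial complex in some Euclidean space. -/
def IsFinitePolyhedron (X : Type u) [TopologicalSpace X] : Prop :=
  ∃ (d : ℕ) (K : Geometry.SimplicialComplex ℝ (EuclideanSpace ℝ (Fin d))),
    K.faces.Finite ∧ Nonempty (X ≃ₜ K.space)

/-- A subset `D` of a topological space is a topological simplex of dimension `m` if, with the
subspace topology, it is homeomorphic to the standard simplex of dimension `m`
(which has `m + 1` vertices). -/
def IsTopologicalSimplex {X : Type u} [TopologicalSpace X] (m : ℕ) (D : Set X) : Prop :=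
  Nonempty (D ≃ₜ stdSimplex ℝ (Fin (m + 1)))

/-! Singular classes have compact carriers, and this forces `f` to respect spheres. Let `M` be a
topological `n`-sphere in `X` and `c` a nonzero class of `H_n(M)`. Since `M \ {p}` is contractible
and `n ≥ 1`, `c` does not come from `M \ {p}` for any `p`. Transport `c` to `f '' M` and take a
compact carrier `K` of the result. If `K` missed some `f p`, naturality would bring `c` back from `M
\ {p}`. Hence `K = f '' M`, and `f` maps `n`-spheres onto compact sets
(`IsHereditaryEquivalence.isCompact_image_sphere`).

Now let `g` be an injective map with this property on a cube of dimension `m ≥ n + 1`. A closed set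
`K` that projects injectively to `n` coordinates lies on the graph of a section. Thickening the
graph in a further coordinate gives an `(n+1)`-cell whose boundary sphere contains `K`. Intersecting
the images of such spheres shows that `g '' K` is closed (`isClosed_image_of_injOn`). For the tails
of a convergent sequence with distinct values in one coordinate, this makes `g a` the only possible
limit of the images. Compactness of `Y` then gives continuity (`MapsSpheresToCompacts.continuous`).

This applies on every facet of `X`, because facets have dimension at least `n + 1`
(`le_of_mem_facets`): near an interior point of a facet there is nothing else, so a small
`(n+1)`-simplex embeds in it, and simplices do not embed in lower dimension. Finitely many closed
facets cover `X`, so `f` is continuous, and a continuous bijection from a compact space to a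
Hausdorff one is a homeomorphism.

Two topological inputs remain, and both rest on Sperner's lemma modulo two for iterated barycentric
subdivisions. Non-embedding follows through Knaster–Kuratowski–Mazurkiewicz and Brouwer. For the
nonvanishing of `H_n` of the simplex boundary, fully labelled small simplices are counted: the
counts are cochains equal to `1` on the fundamental cycle, while on any given boundary they vanish
once the subdivision is fine enough. -/

namespace AffineChain

/-! ### Affine chains modulo two and barycentric subdivision. -/

section Chains

variable {E E' : Type*}

/-- Chains modulo two on the `q`-tuples of points of `E`. -/
abbrev Chain (E : Type*) (q : ℕ) : Type _ := (Fin (q + 1) → E) →₀ ZMod 2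

/-- The boundary of a chain of tuples of points. -/
noncomputable def boundary (E : Type*) (q : ℕ) : Chain E (q + 1) →ₗ[ZMod 2] Chain E q :=
  Finsupp.linearCombination (ZMod 2) fun v => ∑ i : Fin (q + 2), Finsupp.single (v ∘ i.succAbove) 1

/-- The cone over a chain with apex `b`. -/
noncomputable def cone (b : E) (q : ℕ) : Chain E q →ₗ[ZMod 2] Chain E (q + 1) :=
  Finsupp.lmapDomain (ZMod 2) (ZMod 2) fun v => (Fin.cons b v : Fin (q + 2) → E)

@[simp]
lemma boundary_single (q : ℕ) (v : Fin (q + 2) → E) :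
    boundary E q (Finsupp.single v 1) =
      ∑ i : Fin (q + 2), Finsupp.single (v ∘ i.succAbove) 1 := by
  simp [boundary]

@[simp]
lemma cone_single (b : E) (q : ℕ) (v : Fin (q + 1) → E) :
    cone b q (Finsupp.single v 1) = Finsupp.single (Fin.cons b v : Fin (q + 2) → E) 1 := by
  simp [cone]

/-- Two vertices can be deleted in either order with the same result. Exchanging the orders is a
fixed-point-free involution on the terms, which therefore cancel in pairs modulo two. -/
lemma boundary_boundary (q : ℕ) (c : Chain E (q + 2)) :
    boundary E q (boundary E (q + 1) c) = 0 := by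
  suffices h : boundary E q ∘ₗ boundary E (q + 1) = 0 from LinearMap.congr_fun h c
  ext1 v
  refine LinearMap.ext_ring ?_
  simp only [LinearMap.comp_apply, Finsupp.lsingle_apply, boundary_single, map_sum,
    LinearMap.zero_apply]
  rw [← Fintype.sum_prod_type' (fun (i : Fin (q + 3)) (j : Fin (q + 2)) =>
    Finsupp.single ((v ∘ i.succAbove) ∘ j.succAbove) (1 : ZMod 2))]
  have hc : ∀ (i : Fin (q + 3)) (j : Fin (q + 2)),
      (v ∘ (i.succAbove j).succAbove) ∘ (j.predAbove i).succAbove =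
        (v ∘ i.succAbove) ∘ j.succAbove := fun i j => by
    funext k
    simp only [Function.comp_apply, Fin.succAbove_succAbove_succAbove_predAbove]
  refine Finset.sum_involution (fun p _ => (p.1.succAbove p.2, p.2.predAbove p.1)) ?_ ?_ ?_ ?_
  · rintro ⟨i, j⟩ -
    simp only [hc]
    rw [← Finsupp.single_add, show (1 : ZMod 2) + 1 = 0 from rfl, Finsupp.single_zero]
  · rintro ⟨i, j⟩ - -
    intro h
    exact Fin.succAbove_ne i j (congrArg Prod.fst h)
  · simp
  · rintro ⟨i, j⟩ -
    have h1 : (i.succAbove j).succAbove (j.predAbove i) = i := by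
      ext
      simp only [Fin.succAbove, Fin.predAbove, Fin.lt_def, Fin.val_castSucc,
        apply_dite Fin.val, Fin.val_pred, Fin.coe_castPred, dite_eq_ite, apply_ite Fin.val,
        Fin.val_succ]
      split_ifs <;> lia
    have h2 : (j.predAbove i).predAbove (i.succAbove j) = j := by
      ext
      simp only [Fin.succAbove, Fin.predAbove, Fin.lt_def, Fin.val_castSucc,
        apply_dite Fin.val, Fin.val_pred, Fin.coe_castPred, dite_eq_ite, apply_ite Fin.val,
        Fin.val_succ]
      split_ifs <;> lia
    exact Prod.ext h1 h2

lemma boundary_cone (b : E) (q : ℕ) (c : Chain E (q + 1)) :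
    boundary E (q + 1) (cone b (q + 1) c) = c + cone b q (boundary E q c) := by
  suffices h : boundary E (q + 1) ∘ₗ cone b (q + 1) = LinearMap.id + cone b q ∘ₗ boundary E q from
    LinearMap.congr_fun h c
  ext1 v
  refine LinearMap.ext_ring ?_
  simp only [LinearMap.comp_apply, Finsupp.lsingle_apply, boundary_single, map_sum,
    LinearMap.add_apply, LinearMap.id_apply, cone_single]
  rw [Fin.sum_univ_succ]
  congr 1
  refine Finset.sum_congr rfl fun i _ => ?_
  congr 1
  funext k
  refine Fin.cases ?_ (fun k => ?_) k <;> simp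

/-- In degree zero the cone formula has an extra term, the apex. The boundary of an edge has two
endpoints, so the apex appears twice and cancels. -/
lemma boundary_cone_zero (b : E) (c : Chain E 1) :
    boundary E 0 (cone b 0 (boundary E 0 c)) = boundary E 0 c := by
  suffices h : boundary E 0 ∘ₗ cone b 0 ∘ₗ boundary E 0 = boundary E 0 from
    LinearMap.congr_fun h c
  ext1 v
  refine LinearMap.ext_ring ?_
  simp only [LinearMap.comp_apply, Finsupp.lsingle_apply, boundary_single, map_sum, cone_single]
  have h0 : ∀ w : Fin 1 → E, (Fin.cons b w : Fin 2 → E) ∘ Fin.succAbove 0 = w := fun w => by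
    funext k; simp
  have h1 : ∀ w : Fin 1 → E, (Fin.cons b w : Fin 2 → E) ∘ Fin.succAbove 1 = fun _ => b :=
    fun w => by
      funext k
      obtain rfl : k = 0 := Subsingleton.elim _ _
      simp [Fin.succAbove]
  have h3 : ∀ w : Fin 1 → E, ∑ i : Fin (0 + 2), Finsupp.single
      ((Fin.cons b w : Fin (0 + 2) → E) ∘ i.succAbove) (1 : ZMod 2) =
      Finsupp.single w 1 + Finsupp.single (fun _ => b) 1 := fun w => by
    rw [Fin.sum_univ_two, h0, h1]
  have h2 : ∑ _i : Fin (0 + 2), Finsupp.single (fun _ : Fin 1 => b) (1 : ZMod 2) = 0 := by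
    rw [Fin.sum_univ_two, ← Finsupp.single_add, show (1 : ZMod 2) + 1 = 0 from rfl,
      Finsupp.single_zero]
  rw [Finset.sum_congr rfl fun x _ => h3 _, Finset.sum_add_distrib, h2, add_zero]

/-- The map of chains induced by a map of points. -/
noncomputable def map {E E' : Type*} (A : E → E') (q : ℕ) : Chain E q →ₗ[ZMod 2] Chain E' q :=
  Finsupp.lmapDomain (ZMod 2) (ZMod 2) fun v => A ∘ v

@[simp]
lemma map_single (A : E → E') (q : ℕ) (v : Fin (q + 1) → E) (r : ZMod 2) :
    map A q (Finsupp.single v r) = Finsupp.single (A ∘ v) r := by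
  simp [map]

lemma boundary_map (A : E → E') (q : ℕ) (c : Chain E (q + 1)) :
    boundary E' q (map A (q + 1) c) = map A q (boundary E q c) := by
  suffices h : boundary E' q ∘ₗ map A (q + 1) = map A q ∘ₗ boundary E q from
    LinearMap.congr_fun h c
  ext1 v
  refine LinearMap.ext_ring ?_
  simp [Function.comp_assoc]

lemma map_cone (A : E → E') (b : E) (q : ℕ) (c : Chain E q) :
    map A (q + 1) (cone b q c) = cone (A b) q (map A q c) := by
  suffices h : map A (q + 1) ∘ₗ cone b q = cone (A b) q ∘ₗ map A q from
    LinearMap.congr_fun h c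
  ext1 v
  refine LinearMap.ext_ring ?_
  simp only [LinearMap.comp_apply, Finsupp.lsingle_apply, cone_single, map_single]
  congr 1
  funext k
  refine Fin.cases ?_ (fun k => ?_) k <;> simp

lemma mem_of_supported {q : ℕ} {V : Type*} [AddCommGroup V] [Module (ZMod 2) V]
    (f : Chain E q →ₗ[ZMod 2] V) {S : Set (Fin (q + 1) → E)} {N : Submodule (ZMod 2) V}
    (h : ∀ v ∈ S, f (Finsupp.single v 1) ∈ N) {c : Chain E q}
    (hc : c ∈ Finsupp.supported (ZMod 2) (ZMod 2) S) : f c ∈ N := by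
  rw [Finsupp.supported_eq_span_single] at hc
  have : Submodule.span (ZMod 2) ((fun i => Finsupp.single i (1 : ZMod 2)) '' S) ≤ N.comap f := by
    rw [Submodule.span_le]
    rintro _ ⟨v, hv, rfl⟩
    exact h v hv
  exact this hc

variable [AddCommGroup E] [Module ℝ E] [AddCommGroup E'] [Module ℝ E']

/-- The barycenter of a tuple of points. -/
noncomputable def bary {q : ℕ} (v : Fin (q + 1) → E) : E := ((q : ℝ) + 1)⁻¹ • ∑ i, v i

/-- The barycentric subdivision of a chain. -/
noncomputable def sd (E : Type*) [AddCommGroup E] [Module ℝ E] :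
    ∀ q : ℕ, Chain E q →ₗ[ZMod 2] Chain E q
  | 0 => LinearMap.id
  | q + 1 => Finsupp.linearCombination (ZMod 2) fun v =>
      cone (bary v) q (sd E q (boundary E q (Finsupp.single v 1)))

lemma sd_succ_single (q : ℕ) (v : Fin (q + 2) → E) :
    sd E (q + 1) (Finsupp.single v 1) =
      cone (bary v) q (sd E q (boundary E q (Finsupp.single v 1))) := by
  simp [sd]

/-- By induction the subdivided boundary is a cycle, so the cone formula leaves only the base of the
cone. The lowest degree needs `boundary_cone_zero` instead. -/
lemma boundary_sd (q : ℕ) (c : Chain E (q + 1)) :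
    boundary E q (sd E (q + 1) c) = sd E q (boundary E q c) := by
  induction q with
  | zero =>
    suffices h : boundary E 0 ∘ₗ sd E 1 = boundary E 0 from LinearMap.congr_fun h c
    ext1 v
    refine LinearMap.ext_ring ?_
    simp only [LinearMap.comp_apply, Finsupp.lsingle_apply, sd_succ_single]
    exact boundary_cone_zero _ _
  | succ q ih =>
    suffices h : boundary E (q + 1) ∘ₗ sd E (q + 2) = sd E (q + 1) ∘ₗ boundary E (q + 1) from
      LinearMap.congr_fun h c
    ext1 v
    refine LinearMap.ext_ring ?_
    simp only [LinearMap.comp_apply, Finsupp.lsingle_apply]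
    rw [sd_succ_single, boundary_cone, ih, boundary_boundary, map_zero, map_zero, add_zero]

lemma boundary_sd_pow (q k : ℕ) (c : Chain E (q + 1)) :
    boundary E q ((sd E (q + 1) ^ k) c) = (sd E q ^ k) (boundary E q c) := by
  induction k generalizing c with
  | zero => simp
  | succ k ih => rw [pow_succ, pow_succ, Module.End.mul_apply, Module.End.mul_apply, ih, boundary_sd]

lemma map_bary (A : E →ₗ[ℝ] E') {q : ℕ} (v : Fin (q + 1) → E) : A (bary v) = bary (A ∘ v) := by
  simp [bary]

lemma map_sd (A : E →ₗ[ℝ] E') (q : ℕ) (c : Chain E q) :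
    map A q (sd E q c) = sd E' q (map A q c) := by
  induction q with
  | zero => rfl
  | succ q ih =>
    suffices h : map A (q + 1) ∘ₗ sd E (q + 1) = sd E' (q + 1) ∘ₗ map A (q + 1) from
      LinearMap.congr_fun h c
    ext1 v
    refine LinearMap.ext_ring ?_
    simp only [LinearMap.comp_apply, Finsupp.lsingle_apply, map_single]
    rw [sd_succ_single, sd_succ_single, map_cone, ih, ← boundary_map, map_bary, map_single]

lemma map_sd_pow (A : E →ₗ[ℝ] E') (q k : ℕ) (c : Chain E q) :
    map A q ((sd E q ^ k) c) = (sd E' q ^ k) (map A q c) := by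
  induction k generalizing c with
  | zero => simp
  | succ k ih => rw [pow_succ, pow_succ, Module.End.mul_apply, Module.End.mul_apply, ih, map_sd]

end Chains

/-! ### The mesh of iterated subdivisions. -/

section Mesh

variable {E : Type*} [NormedAddCommGroup E] [NormedSpace ℝ E]

/-- The tuples of points of `S` of diameter at most `r`. -/
def tuples (S : Set E) (q : ℕ) (r : ℝ) : Set (Fin (q + 1) → E) :=
  {w | (∀ i, w i ∈ S) ∧ ∀ i j, dist (w i) (w j) ≤ r}

lemma bary_mem {q : ℕ} (v : Fin (q + 1) → E) : bary v ∈ convexHull ℝ (Set.range v) := by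
  have h : (0 : ℝ) < q + 1 := by positivity
  rw [bary, Finset.smul_sum]
  refine (convex_convexHull ℝ _).sum_mem (fun _ _ => by positivity) ?_
    (fun i _ => subset_convexHull ℝ _ ⟨i, rfl⟩)
  simp [h.ne']

/-- The vector `v i - bary v` is the average of the `q + 1` differences `v i - v j`, one of which is
zero; this gives the factor `q / (q + 1)` at vertices. Convexity of balls does the rest. -/
lemma dist_bary_le {q : ℕ} (v : Fin (q + 1) → E) {r : ℝ} (hv : ∀ i j, dist (v i) (v j) ≤ r)
    {x : E} (hx : x ∈ convexHull ℝ (Set.range v)) :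
    dist x (bary v) ≤ (q / (q + 1) : ℝ) * r := by
  have h : (0 : ℝ) < q + 1 := by positivity
  suffices hs : Set.range v ⊆ Metric.closedBall (bary v) ((q / (q + 1) : ℝ) * r) from
    convexHull_min hs (convex_closedBall _ _) hx
  rintro _ ⟨i, rfl⟩
  rw [Metric.mem_closedBall, dist_eq_norm]
  have h1 : v i - bary v = ((q : ℝ) + 1)⁻¹ • ∑ j, (v i - v j) := by
    rw [Finset.sum_sub_distrib, smul_sub, bary]
    congr 1
    simp [← Nat.cast_smul_eq_nsmul ℝ, smul_smul, h.ne']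
  rw [h1, norm_smul, Real.norm_of_nonneg (by positivity)]
  have h2 : ‖∑ j, (v i - v j)‖ ≤ q * r := by
    rw [← Finset.sum_erase Finset.univ (a := i) (by simp)]
    refine (norm_sum_le_of_le _ (f := fun j => v i - v j) (n := fun _ => r) fun j _ => by
      rw [← dist_eq_norm]; exact hv i j).trans ?_
    simp
  calc ((q : ℝ) + 1)⁻¹ * ‖∑ j, (v i - v j)‖ ≤ ((q : ℝ) + 1)⁻¹ * (q * r) := by gcongr
    _ = _ := by ring

lemma sd_single_mem (q : ℕ) (v : Fin (q + 1) → E) {r : ℝ} (hr : 0 ≤ r)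
    (hv : ∀ i j, dist (v i) (v j) ≤ r) :
    sd E q (Finsupp.single v 1) ∈ Finsupp.supported (ZMod 2) (ZMod 2)
      (tuples (convexHull ℝ (Set.range v)) q (q / (q + 1) * r)) := by
  induction q with
  | zero =>
    refine Finsupp.single_mem_supported _ _ ⟨fun i => subset_convexHull ℝ _ ⟨i, rfl⟩, fun i j => ?_⟩
    obtain rfl : i = j := Subsingleton.elim (α := Fin 1) _ _
    simp
  | succ q ih =>
    rw [sd_succ_single]
    refine mem_of_supported (cone (bary v) q)
      (S := tuples (convexHull ℝ (Set.range v)) q (q / (q + 1) * r)) (fun w hw => ?_) ?_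
    · rw [cone_single]
      have hle : (q / (q + 1) : ℝ) * r ≤ ((q + 1 : ℕ) / ((q + 1 : ℕ) + 1) : ℝ) * r := by
        gcongr ?_ * r
        rw [div_le_div_iff₀ (by positivity) (by positivity)]
        push_cast
        nlinarith
      have hb : ∀ i, dist (bary v) (w i) ≤ ((q + 1 : ℕ) / ((q + 1 : ℕ) + 1) : ℝ) * r := fun i => by
        rw [dist_comm]; exact dist_bary_le v hv (hw.1 i)
      refine Finsupp.single_mem_supported _ _ ⟨fun i => ?_, fun i j => ?_⟩
      · refine Fin.cases ?_ (fun i => ?_) i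
        · exact bary_mem v
        · simpa using hw.1 i
      · refine Fin.cases ?_ (fun i => ?_) i <;> refine Fin.cases ?_ (fun j => ?_) j
        · simp only [Fin.cons_zero, dist_self]; positivity
        · simpa using hb j
        · simpa [dist_comm] using hb i
        · simpa using (hw.2 i j).trans hle
    · rw [boundary_single, map_sum]
      refine Submodule.sum_mem _ fun i _ => ?_
      refine Finsupp.supported_mono ?_ (ih (v ∘ i.succAbove) fun _ _ => hv _ _)
      exact fun w hw => ⟨fun i => convexHull_mono (Set.range_comp_subset_range _ _) (hw.1 i), hw.2⟩

lemma sd_pow_mem (q k : ℕ) (v : Fin (q + 1) → E) {r : ℝ} (hr : 0 ≤ r)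
    (hv : ∀ i j, dist (v i) (v j) ≤ r) :
    (sd E q ^ k) (Finsupp.single v 1) ∈ Finsupp.supported (ZMod 2) (ZMod 2)
      (tuples (convexHull ℝ (Set.range v)) q ((q / (q + 1)) ^ k * r)) := by
  induction k with
  | zero =>
    refine Finsupp.single_mem_supported _ _ ⟨fun i => subset_convexHull ℝ _ ⟨i, rfl⟩, fun i j => ?_⟩
    simpa using hv i j
  | succ k ih =>
    rw [pow_succ' (sd E q), Module.End.mul_apply]
    refine mem_of_supported (sd E q) (fun w hw => ?_) ih
    refine Finsupp.supported_mono ?_ (sd_single_mem q w (by positivity) hw.2)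
    rintro u ⟨h1, h2⟩
    refine ⟨fun i => ?_, fun i j => (h2 i j).trans (le_of_eq (by ring))⟩
    exact convexHull_min (Set.range_subset_iff.2 hw.1) (convex_convexHull ℝ _) (h1 i)

end Mesh

/-! ### Labellings and Sperner's lemma. -/

section Labels

/-- The parity of a labelling of the vertices of a simplex: it is `1` if the labels are
`0, …, q`, each occurring once, and `0` otherwise. -/
def parity {q : ℕ} (L : Fin (q + 1) → ℕ) : ZMod 2 :=
  (Matrix.of fun i j : Fin (q + 1) => if L i = j then (1 : ZMod 2) else 0).det

/-- Adding all other columns to the last one does not change the determinant. As every label is at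
most `q + 1`, each row has exactly one entry `1`, so the last column becomes all ones; expand along
it. This is the door-counting step of Sperner's lemma. -/
lemma parity_succ {q : ℕ} (L : Fin (q + 2) → ℕ) (hL : ∀ i, L i ≤ q + 1) :
    parity L = ∑ i : Fin (q + 2), parity (L ∘ i.succAbove) := by
  have h := Matrix.det_updateCol_sum
    (Matrix.of fun i j : Fin (q + 2) => if L i = j then (1 : ZMod 2) else 0) (Fin.last _) 1
  rw [Pi.one_apply, one_smul] at h
  rw [parity, ← h, Matrix.det_succ_column _ (Fin.last _)]
  refine Finset.sum_congr rfl fun i _ => ?_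
  have h1 : ((-1 : ZMod 2)) = 1 := rfl
  rw [h1, one_pow, one_mul, Matrix.updateCol_self]
  have h2 : ∑ j : Fin (q + 2), (1 : Fin (q + 2) → ZMod 2) j •
      (Matrix.of fun i j : Fin (q + 2) => if L i = j then (1 : ZMod 2) else 0) i j = 1 := by
    simp only [Pi.one_apply, Matrix.of_apply, one_smul]
    rw [Finset.sum_eq_single (⟨L i, Nat.lt_succ_of_le (hL i)⟩ : Fin (q + 2))]
    · simp
    · intro j _ hj
      rw [if_neg]
      rintro h
      exact hj (Fin.ext h.symm)
    · simp
  rw [h2, one_mul, parity]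
  congr 1
  ext a b
  simp

lemma parity_eq_zero {q : ℕ} {L : Fin (q + 1) → ℕ} (j : Fin (q + 1)) (hj : ∀ i, L i ≠ j) :
    parity L = 0 :=
  Matrix.det_eq_zero_of_column_eq_zero j fun i => by simp [hj i]

/-- The number of simplices of a chain, modulo two, whose labels are `0, …, q`. -/
noncomputable def count {E : Type*} (lab : E → ℕ) (q : ℕ) : Chain E q →ₗ[ZMod 2] ZMod 2 :=
  Finsupp.linearCombination (ZMod 2) fun w => parity (lab ∘ w)

lemma count_single {E : Type*} (lab : E → ℕ) (q : ℕ) (w : Fin (q + 1) → E) :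
    count lab q (Finsupp.single w 1) = parity (lab ∘ w) := by
  simp [count]

lemma count_map {E E' : Type*} (A : E → E') (lab : E' → ℕ) (q : ℕ) (c : Chain E q) :
    count lab q (map A q c) = count (lab ∘ A) q c := by
  suffices h : count lab q ∘ₗ map A q = count (lab ∘ A) q from LinearMap.congr_fun h c
  ext1 v
  refine LinearMap.ext_ring ?_
  simp [count, map, Function.comp_assoc]

lemma count_eq_zero {E : Type*} {lab : E → ℕ} {q : ℕ} {S : Set (Fin (q + 1) → E)}
    (h : ∀ w ∈ S, parity (lab ∘ w) = 0) {c : Chain E q}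
    (hc : c ∈ Finsupp.supported (ZMod 2) (ZMod 2) S) : count lab q c = 0 := by
  rw [← Submodule.mem_bot (ZMod 2)]
  refine mem_of_supported (count lab q) (fun w hw => ?_) hc
  rw [count_single, h w hw]
  exact Submodule.zero_mem _

lemma count_congr {E : Type*} {lab lab' : E → ℕ} {q : ℕ} {S : Set (Fin (q + 1) → E)}
    (h : ∀ w ∈ S, lab ∘ w = lab' ∘ w) {c : Chain E q}
    (hc : c ∈ Finsupp.supported (ZMod 2) (ZMod 2) S) : count lab q c = count lab' q c := by
  rw [← sub_eq_zero, ← LinearMap.sub_apply, ← Submodule.mem_bot (ZMod 2)]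
  refine mem_of_supported (count lab q - count lab' q) (fun w hw => ?_) hc
  rw [LinearMap.sub_apply, count_single, count_single, h w hw, sub_self]
  exact Submodule.zero_mem _

lemma count_succ {E : Type*} {lab : E → ℕ} {q : ℕ} {S : Set (Fin (q + 2) → E)}
    (h : ∀ w ∈ S, ∀ i, lab (w i) ≤ q + 1) {c : Chain E (q + 1)}
    (hc : c ∈ Finsupp.supported (ZMod 2) (ZMod 2) S) :
    count lab (q + 1) c = count lab q (boundary E q c) := by
  rw [← sub_eq_zero, ← LinearMap.comp_apply, ← LinearMap.sub_apply, ← Submodule.mem_bot (ZMod 2)]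
  refine mem_of_supported (count lab (q + 1) - count lab q ∘ₗ boundary E q) (fun w hw => ?_) hc
  rw [LinearMap.sub_apply, LinearMap.comp_apply, count_single, boundary_single, map_sum,
    parity_succ (lab ∘ w) (h w hw)]
  simp only [count_single, Function.comp_assoc, sub_self, Submodule.zero_mem]

/-- **Sperner's lemma** for iterated barycentric subdivisions. -/
theorem count_sd_pow {E : Type*} [NormedAddCommGroup E] [NormedSpace ℝ E] (p : ℕ → E)
    (lab : E → ℕ) (n : ℕ)
    (h : ∀ S : Set ℕ, S ⊆ Set.Iic n → ∀ x ∈ convexHull ℝ (p '' S), lab x ∈ S) (k : ℕ) :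
    count lab n ((sd E n ^ k) (Finsupp.single (fun i : Fin (n + 1) => p i) 1)) = 1 := by
  have key : ∀ (q : ℕ) (v : Fin (q + 1) → E), ∃ r, (sd E q ^ k) (Finsupp.single v 1) ∈
      Finsupp.supported (ZMod 2) (ZMod 2) (tuples (convexHull ℝ (Set.range v)) q r) := by
    intro q v
    obtain ⟨r, hr⟩ := (Set.finite_range fun a : Fin (q + 1) × Fin (q + 1) =>
      dist (v a.1) (v a.2)).bddAbove
    have hr' : ∀ i j, dist (v i) (v j) ≤ r := fun i j => hr ⟨(i, j), rfl⟩
    exact ⟨_, sd_pow_mem q k v (dist_nonneg.trans (hr' 0 0)) hr'⟩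
  induction n with
  | zero =>
    have : (sd E 0 ^ k) = 1 := by
      have : sd E 0 = 1 := rfl
      rw [this, one_pow]
    rw [this, Module.End.one_apply, count_single]
    have h0 : lab (p 0) = 0 := by
      simpa using h {0} (by simp) (p 0) (subset_convexHull ℝ _ (by simp))
    simp [parity, h0]
  | succ n ih =>
    obtain ⟨r, hr⟩ := key (n + 1) (fun i => p i)
    rw [count_succ (fun w hw i => ?_) hr, boundary_sd_pow, boundary_single, map_sum, map_sum,
      Fin.sum_univ_castSucc, Finset.sum_eq_zero, zero_add]
    · convert ih (fun S hS x hx => h S (hS.trans (Set.Iic_subset_Iic.2 (Nat.le_succ n))) x hx) using 5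
      simp
    -- On the face opposite to a vertex `i ≤ n` the label `i` does not occur, so the face
    -- contributes nothing. Only the face opposite to the last vertex survives, and there induction
    -- applies.
    · intro i _
      obtain ⟨r, hr⟩ := key n ((fun i : Fin (n + 2) => p i) ∘ i.castSucc.succAbove)
      refine count_eq_zero (fun w hw => parity_eq_zero i fun j hj => ?_) hr
      have := h (Set.Iic (n + 1) \ {(i : ℕ)}) Set.sdiff_subset (w j) (convexHull_mono ?_ (hw.1 j))
      · exact this.2 hj
      · rintro _ ⟨l, rfl⟩
        refine ⟨(i.castSucc.succAbove l : Fin (n + 2)), ⟨?_, ?_⟩, rfl⟩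
        · exact Nat.le_of_lt_succ (Fin.is_lt _)
        · intro hl
          exact Fin.succAbove_ne i.castSucc l (Fin.ext (by simpa using hl))
    · refine h (Set.Iic (n + 1)) subset_rfl _ (convexHull_mono ?_ (hw.1 i))
      rintro _ ⟨l, rfl⟩
      exact ⟨l, Nat.le_of_lt_succ l.is_lt, rfl⟩

end Labels

end AffineChain

open scoped unitInterval

open AlgebraicTopology AffineChain

/-! ### The standard simplex: the lemmas of Sperner and Knaster–Kuratowski–Mazurkiewicz, and
Brouwer's theorem. -/

namespace AffineChain

lemma convexHull_vertices_subset (n : ℕ) (S : Set (Fin (n + 1))) :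
    convexHull ℝ ((fun i : Fin (n + 1) => (Pi.single i 1 : Fin (n + 1) → ℝ)) '' S) ⊆
      {x ∈ stdSimplex ℝ (Fin (n + 1)) | ∀ j ∉ S, x j = 0} := by
  refine convexHull_min ?_ ?_
  · rintro _ ⟨i, hi, rfl⟩
    refine ⟨single_mem_stdSimplex ℝ i, fun j hj => ?_⟩
    exact Pi.single_eq_of_ne (fun h : j = i => hj (h ▸ hi)) _
  · intro x hx y hy a b ha hb hab
    refine ⟨convex_stdSimplex ℝ _ hx.1 hy.1 ha hb hab, fun j hj => ?_⟩
    simp [hx.2 j hj, hy.2 j hj]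

lemma count_sd_pow_stdSimplex (n k : ℕ) (lab : (Fin (n + 1) → ℝ) → Fin (n + 1))
    (h : ∀ x ∈ stdSimplex ℝ (Fin (n + 1)), x (lab x) ≠ 0) :
    count (fun x => (lab x : ℕ)) n
      ((sd _ n ^ k) (Finsupp.single (fun i : Fin (n + 1) => Pi.single i 1) 1)) = 1 := by
  -- The value `0` beyond index `n` is never used: only index sets inside `Set.Iic n` are
  -- considered.
  let p : ℕ → Fin (n + 1) → ℝ := fun i =>
    if hi : i < n + 1 then Pi.single (⟨i, hi⟩ : Fin (n + 1)) 1 else 0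
  have hp : (fun i : Fin (n + 1) => p i) = fun i => Pi.single i 1 := by
    funext i
    simp only [p, dif_pos i.is_lt]
  rw [← hp]
  refine count_sd_pow p _ n (fun S hS x hx => ?_) k
  have hsub : p '' S ⊆ (fun i : Fin (n + 1) => (Pi.single i 1 : Fin (n + 1) → ℝ)) ''
      {i | (i : ℕ) ∈ S} := by
    rintro _ ⟨i, hi, rfl⟩
    refine ⟨⟨i, Nat.lt_succ_of_le (hS hi)⟩, hi, ?_⟩
    simp only [p, dif_pos (Nat.lt_succ_of_le (hS hi))]
  have := convexHull_vertices_subset n _ (convexHull_mono hsub hx)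
  by_contra hn
  exact h x this.1 (this.2 _ hn)

lemma sd_pow_stdSimplex_mem (n k : ℕ) :
    (sd _ n ^ k) (Finsupp.single (fun i : Fin (n + 1) => (Pi.single i 1 : Fin (n + 1) → ℝ)) 1) ∈
      Finsupp.supported (ZMod 2) (ZMod 2)
        (tuples (stdSimplex ℝ (Fin (n + 1))) n ((n / (n + 1)) ^ k)) := by
  have := sd_pow_mem n k (fun i : Fin (n + 1) => (Pi.single i 1 : Fin (n + 1) → ℝ)) (r := 1)
    zero_le_one fun i j => ?_
  · rwa [mul_one, convexHull_rangle_single_eq_stdSimplex] at this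
  · exact (Metric.dist_le_diam_of_mem (bounded_stdSimplex _) (single_mem_stdSimplex ℝ i)
      (single_mem_stdSimplex ℝ j)).trans diam_stdSimplex_le

lemma exists_pow_lt (n : ℕ) {δ : ℝ} (hδ : 0 < δ) :
    ∃ k₀ : ℕ, ∀ k ≥ k₀, ((n : ℝ) / (n + 1)) ^ k < δ := by
  have h : Filter.Tendsto (fun k : ℕ => ((n : ℝ) / (n + 1)) ^ k) Filter.atTop (nhds 0) :=
    tendsto_pow_atTop_nhds_zero_of_lt_one (by positivity)
      ((div_lt_one (by positivity)).2 (by linarith))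
  exact Filter.eventually_atTop.1 (h.eventually_lt_const hδ)

end AffineChain

/-- The **Knaster–Kuratowski–Mazurkiewicz lemma**. -/
theorem stdSimplex.exists_mem_iInter_of_isClosed {n : ℕ}
    (A : Fin (n + 1) → Set (stdSimplex ℝ (Fin (n + 1)))) (hA : ∀ i, IsClosed (A i))
    (h : ∀ x : stdSimplex ℝ (Fin (n + 1)), ∃ i, x i ≠ 0 ∧ x ∈ A i) :
    ∃ x, ∀ i, x ∈ A i := by
  classical
  by_contra! hne
  -- If no point lies in all `A i`, the complements form an open cover. A simplex smaller than its
  -- Lebesgue number lies in the complement of one `A i`, so it cannot carry the label `i`, against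
  -- Sperner.
  obtain ⟨δ, hδ, hball⟩ := lebesgue_number_lemma_of_metric
    (isCompact_univ (X := stdSimplex ℝ (Fin (n + 1)))) (fun i => (hA i).isOpen_compl)
    (fun x _ => by simpa using hne x)
  choose l hl using h
  let lab : (Fin (n + 1) → ℝ) → Fin (n + 1) := fun x =>
    if hx : x ∈ stdSimplex ℝ (Fin (n + 1)) then l ⟨x, hx⟩ else 0
  obtain ⟨k, hk⟩ := exists_pow_lt n hδ
  have h1 := count_sd_pow_stdSimplex n k lab fun x hx => by
    have := (hl ⟨x, hx⟩).1
    simp only [lab, dif_pos hx]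
    exact this
  rw [count_eq_zero (fun w hw => ?_) (sd_pow_stdSimplex_mem n k)] at h1
  · exact zero_ne_one h1
  · obtain ⟨i, hi⟩ := hball ⟨w 0, hw.1 0⟩ trivial
    refine parity_eq_zero i fun j hj => ?_
    have hmem : (⟨w j, hw.1 j⟩ : stdSimplex ℝ (Fin (n + 1))) ∈ Metric.ball ⟨w 0, hw.1 0⟩ δ :=
      (hw.2 j 0).trans_lt (hk k le_rfl)
    refine hi hmem ?_
    have hj' : l ⟨w j, hw.1 j⟩ = i := by
      simpa [lab, hw.1 j, Fin.ext_iff] using hj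
    exact hj' ▸ (hl ⟨w j, hw.1 j⟩).2

/-- **Brouwer's fixed point theorem** for the standard simplex. -/
theorem stdSimplex.exists_fixedPoint {n : ℕ}
    (F : C(stdSimplex ℝ (Fin (n + 1)), stdSimplex ℝ (Fin (n + 1)))) : ∃ x, F x = x := by
  have hc : ∀ i, Continuous fun x : stdSimplex ℝ (Fin (n + 1)) => x i := fun i =>
    (continuous_apply i).comp continuous_subtype_val
  -- Some coordinate `i` with `x i ≠ 0` must satisfy `F x i ≤ x i`, since otherwise the coordinate
  -- sum of `F x` would exceed that of `x`. At a common point all these inequalities hold, and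
  -- equality of the sums makes them equalities.
  obtain ⟨x, hx⟩ := stdSimplex.exists_mem_iInter_of_isClosed
    (fun i => {x | F x i ≤ x i}) (fun i => isClosed_le ((hc i).comp F.continuous) (hc i))
    (fun x => by
      by_contra! hx
      have h1 : ∀ i, x i ≤ F x i := fun i => by
        by_cases h0 : x i = 0
        · rw [h0]; exact (F x).2.1 i
        · exact (not_le.1 (hx i h0)).le
      have h2 : ∃ i, x i ≠ 0 := by
        by_contra! h0
        have := stdSimplex.sum_eq_one x
        simp [h0] at this
      obtain ⟨i, hi⟩ := h2
      have h3 : ∑ i, x i < ∑ i, F x i :=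
        Finset.sum_lt_sum (fun i _ => h1 i) ⟨i, Finset.mem_univ _, not_le.1 (hx i hi)⟩
      rw [stdSimplex.sum_eq_one, stdSimplex.sum_eq_one] at h3
      exact lt_irrefl _ h3)
  refine ⟨x, stdSimplex.ext (funext fun i => ?_)⟩
  have h1 : ∑ i, (x i - F x i) = 0 := by
    rw [Finset.sum_sub_distrib, stdSimplex.sum_eq_one, stdSimplex.sum_eq_one, sub_self]
  have := (Finset.sum_eq_zero_iff_of_nonneg fun i _ => sub_nonneg.2 (hx i)).1 h1 i
    (Finset.mem_univ i)
  linarith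

/-- A simplex of dimension `n` does not embed into a vector space of dimension less than `n`. -/
theorem stdSimplex.le_finrank_of_injective {n : ℕ} {V : Type*} [NormedAddCommGroup V]
    [NormedSpace ℝ V] [FiniteDimensional ℝ V] {e : stdSimplex ℝ (Fin (n + 1)) → V}
    (he : Continuous e) (hinj : Function.Injective e) : n ≤ Module.finrank ℝ V := by
  by_contra! hlt
  have hpr : Continuous fun (x : stdSimplex ℝ (Fin (n + 1))) (i : Fin n) => x i.succ :=
    continuous_pi fun i => (continuous_apply i.succ).comp continuous_subtype_val
  -- Tietze extends the inverse of `e`, read in the last `n` coordinates, to all of `V`. A `C¹`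
  -- approximation `g` of it has range with dense complement for dimension reasons.
  obtain ⟨r, hr⟩ := ContinuousMap.exists_extension' (he.isClosedEmbedding hinj)
    (⟨_, hpr⟩ : C(stdSimplex ℝ (Fin (n + 1)), Fin n → ℝ))
  -- Chosen so that moving every coordinate of the barycenter by at most `2 * ε` stays inside the
  -- simplex: `n * (1 / (n + 1) + 2 * ε) ≤ 1`.
  set ε : ℝ := (2 * (n + 1) ^ 2 : ℝ)⁻¹ with hε
  have hε0 : 0 < ε := by positivity
  obtain ⟨g, hg, hgr, -⟩ := r.continuous.exists_contDiff_approx 1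
    (continuous_const (y := ε)) fun _ => hε0
  have hdense := hg.dense_compl_range_of_finrank_lt_finrank (by simpa using hlt)
  obtain ⟨q, hqb, hq⟩ := Metric.dense_iff.1 hdense (fun _ => (n + 1 : ℝ)⁻¹) ε hε0
  have hn : (0 : ℝ) < n + 1 := by positivity
  -- A fixed point of this self-map satisfies `g (e x) = q`, whereas `q` was chosen outside the
  -- range of `g`.
  let y : stdSimplex ℝ (Fin (n + 1)) → Fin n → ℝ := fun x i => x i.succ - g (e x) i + q i
  have hy : ∀ x i, |y x i - (n + 1 : ℝ)⁻¹| ≤ 2 * ε := fun x i => by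
    have h1 : |g (e x) i - x i.succ| ≤ ε := by
      have := (dist_le_pi_dist (g (e x)) (r (e x)) i).trans (hgr (e x)).le
      rwa [Real.dist_eq, show r (e x) = fun i : Fin n => x i.succ from congrFun hr x] at this
    have h2 : |q i - (n + 1 : ℝ)⁻¹| ≤ ε := by
      have := (dist_le_pi_dist q (fun _ => (n + 1 : ℝ)⁻¹) i).trans (Metric.mem_ball.1 hqb).le
      rwa [Real.dist_eq] at this
    rw [abs_le] at h1 h2 ⊢
    constructor <;> simp only [y] <;> linarith [h1.1, h1.2, h2.1, h2.2]
  have hε1 : 2 * ε * (n + 1) = (n + 1 : ℝ)⁻¹ := by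
    rw [hε]; field_simp
  have hε2 : 2 * ε ≤ (n + 1 : ℝ)⁻¹ := by
    rw [← hε1]; nlinarith [(Nat.cast_nonneg n : (0 : ℝ) ≤ n)]
  have hmem : ∀ x, (Fin.cons (1 - ∑ i, y x i) (y x) : Fin (n + 1) → ℝ) ∈
      stdSimplex ℝ (Fin (n + 1)) := fun x => by
    refine ⟨fun i => Fin.cases ?_ (fun i => ?_) i, by simp [Fin.sum_univ_succ]⟩
    · rw [Fin.cons_zero, sub_nonneg]
      calc ∑ i, y x i ≤ ∑ _i : Fin n, ((n + 1 : ℝ)⁻¹ + 2 * ε) :=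
            Finset.sum_le_sum fun i _ => by linarith [(abs_le.1 (hy x i)).2]
        _ = (n : ℝ) * ((n + 1 : ℝ)⁻¹ + 2 * ε) := by simp [mul_add]
        _ ≤ (n + 1 : ℝ) * (n + 1 : ℝ)⁻¹ := by
            have : (n + 1 : ℝ) * (n + 1 : ℝ)⁻¹ = n * (n + 1 : ℝ)⁻¹ + 2 * ε * (n + 1) := by
              rw [hε1]; ring
            rw [this]
            nlinarith
        _ = 1 := mul_inv_cancel₀ hn.ne'
    · rw [Fin.cons_succ]
      linarith [(abs_le.1 (hy x i)).1]
  have hgc : ∀ i, Continuous fun x => g (e x) i := fun i =>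
    (continuous_apply i).comp (hg.continuous.comp he)
  have hyc : Continuous y := continuous_pi fun i =>
    (((continuous_apply i).comp hpr).sub (hgc i)).add continuous_const
  have hF : Continuous fun x => (Fin.cons (1 - ∑ i, y x i) (y x) : Fin (n + 1) → ℝ) :=
    continuous_pi fun i => Fin.cases (by simp only [Fin.cons_zero]; fun_prop)
      (fun i => by simp only [Fin.cons_succ]; fun_prop) i
  obtain ⟨x, hx⟩ := stdSimplex.exists_fixedPoint ⟨fun x => ⟨_, hmem x⟩, hF.subtype_mk hmem⟩
  refine hq ⟨e x, funext fun i => ?_⟩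
  have h1 : y x i = x i.succ := by
    have := congrArg (fun z : stdSimplex ℝ (Fin (n + 1)) => z i.succ) hx
    exact this
  simp only [y] at h1
  linarith

/-! ### Singular chains and compact carriers. -/

section SingularChains

open scoped Simplicial

/-- The functor of singular chains with integer coefficients. -/
noncomputable abbrev singularChainsInt : TopCat.{u} ⥤ ChainComplex AddCommGrpCat.{u} ℕ :=
  (singularChainComplexFunctor AddCommGrpCat.{u}).obj (AddCommGrpCat.of (ULift.{u} ℤ))

/-- A multiple of a singular simplex, as a singular chain. -/
noncomputable def singularChain {T : TopCat.{u}} {n : ℕ}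
    (s : C(stdSimplex ℝ (Fin (n + 1)), T)) :
    AddCommGrpCat.of (ULift.{u} ℤ) ⟶ (singularChainsInt.obj T).X n :=
  (TopCat.toSSet.obj T).ιChainComplex ((TopCat.toSSetObjEquiv T (.op ⦋n⦌)).symm s)

lemma singularChain_map {T T' : TopCat.{u}} (f : T ⟶ T') {n : ℕ}
    (s : C(stdSimplex ℝ (Fin (n + 1)), T)) :
    singularChain s ≫ (singularChainsInt.map f).f n = singularChain (f.hom.comp s) :=
  SSet.ι_chainComplexMap_f _ _ (TopCat.toSSet.map f) _ _

lemma singularChain_d {T : TopCat.{u}} {n : ℕ} (s : C(stdSimplex ℝ (Fin (n + 2)), T)) :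
    singularChain s ≫ (singularChainsInt.obj T).d (n + 1) n =
      ∑ i : Fin (n + 2), (-1) ^ i.val • singularChain
        (s.comp ⟨stdSimplex.map i.succAbove, stdSimplex.continuous_map _⟩) :=
  SSet.ιChainComplex_d (TopCat.toSSet.obj T) _ _

lemma singularChains_hom_ext {T : TopCat.{u}} {n : ℕ} {G : AddCommGrpCat.{u}}
    {f g : (singularChainsInt.obj T).X n ⟶ G}
    (h : ∀ s : C(stdSimplex ℝ (Fin (n + 1)), T), singularChain s ≫ f = singularChain s ≫ g) :
    f = g :=
  SSet.chainComplex_hom_ext (X := TopCat.toSSet.obj T) fun x => by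
    have := h (TopCat.toSSetObjEquiv T (.op ⦋n⦌) x)
    rwa [singularChain, Equiv.symm_apply_apply] at this

/-- The quotient map by `S` kills the multiples of all singular simplices, hence is zero. -/
lemma singularChains_induction {T : TopCat.{u}} {n : ℕ}
    (S : AddSubgroup ((singularChainsInt.obj T).X n))
    (h : ∀ (s : C(stdSimplex ℝ (Fin (n + 1)), T)) (r : ULift.{u} ℤ), singularChain s r ∈ S)
    (c : (singularChainsInt.obj T).X n) : c ∈ S := by
  have : AddCommGrpCat.ofHom (QuotientAddGroup.mk' S) =
      (0 : (singularChainsInt.obj T).X n ⟶ AddCommGrpCat.of (_ ⧸ S)) :=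
    singularChains_hom_ext fun s => by
      ext r
      exact (QuotientAddGroup.eq_zero_iff _).2 (h s _)
  exact (QuotientAddGroup.eq_zero_iff c).1 (ConcreteCategory.congr_hom this c)

/-- A homomorphism on singular chains, given by its values on singular simplices. -/
noncomputable def singularChainsDesc {T : TopCat.{u}} {n : ℕ} {G : AddCommGrpCat.{u}}
    (θ : C(stdSimplex ℝ (Fin (n + 1)), T) → (AddCommGrpCat.of (ULift.{u} ℤ) ⟶ G)) :
    (singularChainsInt.obj T).X n ⟶ G :=
  Limits.Sigma.desc fun x => θ (TopCat.toSSetObjEquiv T (.op ⦋n⦌) x)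

lemma singularChain_desc {T : TopCat.{u}} {n : ℕ} {G : AddCommGrpCat.{u}}
    (θ : C(stdSimplex ℝ (Fin (n + 1)), T) → (AddCommGrpCat.of (ULift.{u} ℤ) ⟶ G))
    (s : C(stdSimplex ℝ (Fin (n + 1)), T)) :
    singularChain s ≫ singularChainsDesc θ = θ s := by
  refine (Limits.Sigma.ι_desc _ _).trans ?_
  rw [Equiv.apply_symm_apply]

lemma singularChains_map_injective {T T' : TopCat.{u}} (f : T ⟶ T')
    (hf : Function.Injective f) (n : ℕ) :
    Function.Injective ((singularChainsInt.map f).f n) := by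
  rw [← AddCommGrpCat.mono_iff_injective]
  have : Mono f := (TopCat.mono_iff_injective f).2 hf
  have : Mono (singularChainsInt.map f) := inferInstance
  infer_instance

lemma subspaceInclusion_injective {X : Type u} [TopologicalSpace X] {N M : Set X} (h : N ⊆ M) :
    Function.Injective (subspaceInclusion h) :=
  Set.inclusion_injective h

lemma subspaceInclusion_comp {X : Type u} [TopologicalSpace X] {L N M : Set X} (h : L ⊆ N)
    (h' : N ⊆ M) :
    subspaceInclusion h ≫ subspaceInclusion h' = subspaceInclusion (h.trans h') := rfl

/-- A simplex is carried by its compact image, and carriers of sums are unions of carriers. -/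
lemma singularChains_exists_isCompact {X : Type u} [TopologicalSpace X] (A : Set X) (n : ℕ)
    (c : (singularChainsInt.obj (TopCat.of A)).X n) :
    ∃ (K : Set X) (h : K ⊆ A), IsCompact K ∧
      c ∈ ((singularChainsInt.map (subspaceInclusion h)).f n).hom.range := by
  have mono : ∀ {K L : Set X} (hKL : K ⊆ L) (hL : L ⊆ A),
      ((singularChainsInt.map (subspaceInclusion (hKL.trans hL))).f n).hom.range ≤
        ((singularChainsInt.map (subspaceInclusion hL)).f n).hom.range := by
    rintro K L hKL hL _ ⟨w, rfl⟩
    refine ⟨(singularChainsInt.map (subspaceInclusion hKL)).f n w, ?_⟩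
    rw [← subspaceInclusion_comp hKL hL, Functor.map_comp]
    rfl
  let S : AddSubgroup ((singularChainsInt.obj (TopCat.of A)).X n) :=
    { carrier := {c | ∃ (K : Set X) (h : K ⊆ A), IsCompact K ∧
        c ∈ ((singularChainsInt.map (subspaceInclusion h)).f n).hom.range}
      zero_mem' := ⟨∅, Set.empty_subset A, isCompact_empty, AddSubgroup.zero_mem _⟩
      add_mem' := by
        rintro a b ⟨K, hK, hKc, ha⟩ ⟨L, hL, hLc, hb⟩
        exact ⟨K ∪ L, Set.union_subset hK hL, hKc.union hLc, AddSubgroup.add_mem _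
          (mono Set.subset_union_left _ ha) (mono Set.subset_union_right _ hb)⟩
      neg_mem' := by
        rintro a ⟨K, hK, hKc, ha⟩
        exact ⟨K, hK, hKc, AddSubgroup.neg_mem _ ha⟩ }
  refine singularChains_induction S (fun s r => ?_) c
  have hs : ∀ x, ((s x : A) : X) ∈ Subtype.val '' Set.range s := fun x => ⟨_, ⟨x, rfl⟩, rfl⟩
  have hsub : Subtype.val '' Set.range s ⊆ A := by rintro _ ⟨y, -, rfl⟩; exact y.2
  refine ⟨Subtype.val '' Set.range s, hsub,
    (isCompact_range s.continuous).image continuous_subtype_val, ?_⟩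
  let s' : C(stdSimplex ℝ (Fin (n + 1)), TopCat.of (Subtype.val '' Set.range s : Set X)) :=
    ⟨fun x => ⟨(s x : A), hs x⟩, (continuous_subtype_val.comp s.continuous).subtype_mk hs⟩
  exact ⟨singularChain s' r, ConcreteCategory.congr_hom (singularChain_map (subspaceInclusion hsub) s') r⟩

/-- Singular homology classes have compact carriers. -/
theorem singularHomologyInt_exists_isCompact {X : Type u} [TopologicalSpace X] (A : Set X) (n : ℕ)
    (c : (singularHomologyInt.{u} n).obj (TopCat.of A)) :
    ∃ (K : Set X) (h : K ⊆ A), IsCompact K ∧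
      c ∈ Set.range ((singularHomologyInt n).map (subspaceInclusion h)) := by
  obtain ⟨z, rfl⟩ := (AddCommGrpCat.epi_iff_surjective
    ((singularChainsInt.obj (TopCat.of A)).homologyπ n)).1 inferInstance c
  obtain ⟨K, hK, hKc, w, hw⟩ := singularChains_exists_isCompact A n
    ((singularChainsInt.obj (TopCat.of A)).iCycles n z)
  refine ⟨K, hK, hKc, ?_⟩
  set i := singularChainsInt.map (subspaceInclusion hK) with hi
  set m := (ComplexShape.down ℕ).next n with hm
  -- The chain `w` in `K` is itself a cycle, because inclusions are injective on chains.
  have hdw : (singularChainsInt.obj (TopCat.of K)).d n m w = 0 := by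
    refine singularChains_map_injective (subspaceInclusion hK) (subspaceInclusion_injective hK) m ?_
    rw [map_zero]
    have h1 := ConcreteCategory.congr_hom (i.comm n m) w
    have h2 := ConcreteCategory.congr_hom
      ((singularChainsInt.obj (TopCat.of A)).iCycles_d n m) z
    rw [ConcreteCategory.comp_apply, ConcreteCategory.comp_apply] at h1
    rw [ConcreteCategory.comp_apply] at h2
    refine h1.symm.trans ?_
    refine (congrArg _ hw).trans h2
  let D : AddCommGrpCat := AddCommGrpCat.of ((singularChainsInt.obj (TopCat.of K)).d n m).hom.ker
  let k : D ⟶ (singularChainsInt.obj (TopCat.of K)).X n := AddCommGrpCat.ofHom (AddSubgroup.subtype _)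
  have hk : k ≫ (singularChainsInt.obj (TopCat.of K)).d n m = 0 := by
    ext x
    exact x.2
  let w' : D := ⟨w, hdw⟩
  refine ⟨(singularChainsInt.obj (TopCat.of K)).homologyπ n
    ((singularChainsInt.obj (TopCat.of K)).liftCycles k m hm.symm hk w'), ?_⟩
  have h3 := ConcreteCategory.congr_hom (HomologicalComplex.homologyπ_naturality i n)
    ((singularChainsInt.obj (TopCat.of K)).liftCycles k m hm.symm hk w')
  rw [ConcreteCategory.comp_apply, ConcreteCategory.comp_apply] at h3
  refine h3.trans (congrArg _ ?_)
  refine (AddCommGrpCat.mono_iff_injective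
    ((singularChainsInt.obj (TopCat.of A)).iCycles n)).1 inferInstance ?_
  have h4 := ConcreteCategory.congr_hom (HomologicalComplex.cyclesMap_i i n)
    ((singularChainsInt.obj (TopCat.of K)).liftCycles k m hm.symm hk w')
  rw [ConcreteCategory.comp_apply, ConcreteCategory.comp_apply] at h4
  refine h4.trans (Eq.trans (congrArg _ ?_) hw)
  exact ConcreteCategory.congr_hom
    ((singularChainsInt.obj (TopCat.of K)).liftCycles_i k m hm.symm hk) w'

/-- By homotopy invariance the identity on homology factors through the homology of a point. -/
lemma singularHomologyInt_isZero_of_contractible (T : TopCat.{u}) [ContractibleSpace T] {n : ℕ}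
    (hn : n ≠ 0) : Limits.IsZero ((singularHomologyInt n).obj T) := by
  obtain ⟨p, ⟨H⟩⟩ := id_nullhomotopic T
  have hP : Limits.IsZero ((singularHomologyInt.{u} n).obj (TopCat.of PUnit.{u + 1})) :=
    isZero_singularHomologyFunctor_of_totallyDisconnectedSpace _ n _ _ hn
  let a : T ⟶ TopCat.of PUnit.{u + 1} := TopCat.ofHom (ContinuousMap.const _ PUnit.unit)
  let b : TopCat.of PUnit.{u + 1} ⟶ T := TopCat.ofHom (ContinuousMap.const _ p)
  have h : (singularHomologyInt n).map (𝟙 T) = (singularHomologyInt n).map (a ≫ b) :=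
    TopCat.Homotopy.congr_homologyMap_singularChainComplexFunctor
      (f := 𝟙 T) (g := a ≫ b) H _ n
  rw [Limits.IsZero.iff_id_eq_zero]
  refine ((singularHomologyInt n).map_id T).symm.trans (h.trans ?_)
  rw [Functor.map_comp, hP.eq_of_tgt ((singularHomologyInt n).map a) 0, Limits.zero_comp]

end SingularChains

/-! ### Sperner counts on singular simplices and the homology of the simplex boundary. -/

namespace AffineChain

/-- The standard simplex, as a chain. -/
noncomputable def idChain (q : ℕ) : Chain (Fin (q + 1) → ℝ) q :=
  Finsupp.single (fun i => Pi.single i 1) 1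

open Classical in
/-- The extension of a labelling of the standard simplex by zero. -/
noncomputable def extend {q : ℕ} (g : stdSimplex ℝ (Fin (q + 1)) → ℕ) (x : Fin (q + 1) → ℝ) : ℕ :=
  if hx : x ∈ stdSimplex ℝ (Fin (q + 1)) then g ⟨x, hx⟩ else 0

lemma extend_of_mem {q : ℕ} (g : stdSimplex ℝ (Fin (q + 1)) → ℕ) {x : Fin (q + 1) → ℝ}
    (hx : x ∈ stdSimplex ℝ (Fin (q + 1))) : extend g x = g ⟨x, hx⟩ :=
  dif_pos hx

/-- Face inclusions are linear, so they commute with subdivision. This computes the coboundary of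
the counting cochains used below. -/
lemma sum_count_faces {q : ℕ} (g : stdSimplex ℝ (Fin (q + 2)) → ℕ) (k : ℕ) :
    ∑ i : Fin (q + 2), count (extend fun x => g (stdSimplex.map i.succAbove x)) q
      ((sd _ q ^ k) (idChain q)) =
      count (extend g) q (boundary _ q ((sd _ (q + 1) ^ k) (idChain (q + 1)))) := by
  rw [boundary_sd_pow, idChain, idChain, boundary_single, map_sum, map_sum]
  refine Finset.sum_congr rfl fun i _ => ?_
  have h1 : Finsupp.single ((fun j : Fin (q + 2) => (Pi.single j 1 : Fin (q + 2) → ℝ)) ∘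
      i.succAbove) (1 : ZMod 2) = map (FunOnFinite.linearMap ℝ ℝ i.succAbove) q
        (Finsupp.single (fun j => Pi.single j 1) 1) := by
    rw [map_single]
    congr 1
    funext j
    simp
  rw [h1, ← map_sd_pow, count_map]
  refine count_congr (fun w hw => ?_) (sd_pow_stdSimplex_mem q k)
  funext j
  have h2 : FunOnFinite.linearMap ℝ ℝ i.succAbove (w j) ∈ stdSimplex ℝ (Fin (q + 2)) :=
    (stdSimplex.map i.succAbove ⟨w j, hw.1 j⟩).2
  simp only [Function.comp_apply]
  rw [extend_of_mem _ (hw.1 j), extend_of_mem _ h2]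
  rfl

lemma count_boundary_sd_pow {q : ℕ} (g : stdSimplex ℝ (Fin (q + 2)) → ℕ)
    (hg : ∀ x, g x ≤ q + 1) (k : ℕ) :
    count (extend g) q (boundary _ q ((sd _ (q + 1) ^ k) (idChain (q + 1)))) =
      count (extend g) (q + 1) ((sd _ (q + 1) ^ k) (idChain (q + 1))) := by
  refine (count_succ (fun w hw i => ?_) (sd_pow_stdSimplex_mem (q + 1) k)).symm
  rw [extend_of_mem _ (hw.1 i)]
  exact hg _

lemma exists_argmax {q : ℕ} (x : Fin (q + 1) → ℝ) : ∃ i, ∀ j, x j ≤ x i := by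
  simpa using Finset.exists_max_image Finset.univ x Finset.univ_nonempty

/-- The index of a largest coordinate. -/
noncomputable def argmax {q : ℕ} (x : Fin (q + 1) → ℝ) : Fin (q + 1) := (exists_argmax x).choose

lemma le_argmax {q : ℕ} {x : Fin (q + 1) → ℝ} (hx : x ∈ stdSimplex ℝ (Fin (q + 1))) :
    (q + 1 : ℝ)⁻¹ ≤ x (argmax x) := by
  have h : ∑ i, x i ≤ ∑ _i : Fin (q + 1), x (argmax x) :=
    Finset.sum_le_sum fun i _ => (exists_argmax x).choose_spec i
  rw [hx.2] at h
  rw [inv_le_iff_one_le_mul₀' (by positivity)]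
  simpa using h

/-- For a continuous map of the simplex to its boundary, the labels of all the vertices of a
sufficiently small simplex do not exhaust the set of labels. -/
lemma eventually_count_eq_zero {q : ℕ}
    (s : C(stdSimplex ℝ (Fin (q + 1)), stdSimplex ℝ (Fin (q + 1)))) (hs : ∀ x, ∃ i, s x i = 0) :
    ∃ k₀, ∀ k ≥ k₀, count (extend fun x => (argmax (s x) : ℕ)) q ((sd _ q ^ k) (idChain q)) = 0 := by
  -- The largest coordinate is at least the mean `1 / (q + 1)`. Where `s x i` is below this bound,
  -- the label `i` is impossible; these sets cover the simplex because `s` lands in its boundary.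
  obtain ⟨δ, hδ, hball⟩ := lebesgue_number_lemma_of_metric
    (isCompact_univ (X := stdSimplex ℝ (Fin (q + 1))))
    (c := fun i => {x | s x i < (q + 1 : ℝ)⁻¹})
    (fun i => isOpen_lt ((continuous_apply i).comp
      (continuous_subtype_val.comp s.continuous)) continuous_const)
    (fun x _ => by
      obtain ⟨i, hi⟩ := hs x
      refine Set.mem_iUnion.2 ⟨i, ?_⟩
      simp only [Set.mem_ofPred_eq, hi]
      positivity)
  obtain ⟨k₀, hk₀⟩ := exists_pow_lt q hδ
  refine ⟨k₀, fun k hk => count_eq_zero (fun w hw => ?_) (sd_pow_stdSimplex_mem q k)⟩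
  obtain ⟨i, hi⟩ := hball ⟨w 0, hw.1 0⟩ trivial
  refine parity_eq_zero i fun j hj => ?_
  have hmem : (⟨w j, hw.1 j⟩ : stdSimplex ℝ (Fin (q + 1))) ∈ Metric.ball ⟨w 0, hw.1 0⟩ δ :=
    (hw.2 j 0).trans_lt (hk₀ k hk)
  rw [Function.comp_apply, extend_of_mem _ (hw.1 j), Fin.val_inj] at hj
  have h1 := le_argmax (s ⟨w j, hw.1 j⟩).2
  have h2 : s ⟨w j, hw.1 j⟩ i < (q + 1 : ℝ)⁻¹ := hi hmem
  exact absurd (h1.trans_lt (hj ▸ h2 : s ⟨w j, hw.1 j⟩ (argmax (s ⟨w j, hw.1 j⟩)) < _))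
    (lt_irrefl _)

end AffineChain

/-- Multiplication by `a`, as a homomorphism from the integers. -/
noncomputable def mulHom (a : ZMod 2) :
    AddCommGrpCat.of (ULift.{u} ℤ) ⟶ AddCommGrpCat.of (ULift.{u} (ZMod 2)) :=
  AddCommGrpCat.ofHom
    { toFun := fun r => ⟨(r.down : ZMod 2) * a⟩
      map_zero' := by ext; simp
      map_add' := fun r s => by ext; simp [add_mul] }

lemma mulHom_zero : mulHom.{u} 0 = 0 := by
  ext r
  exact mul_zero _

/-- Signs disappear modulo two, so singular boundaries with signs match the unsigned boundary of
affine chains. -/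
lemma sum_neg_one_pow_smul_mulHom {n : ℕ} (a : Fin n → ZMod 2) :
    ∑ i : Fin n, (-1) ^ i.val • mulHom.{u} (a i) = mulHom (∑ i, a i) := by
  have h : ∀ (k : ℕ) (a : ZMod 2), (-1 : ℤ) ^ k • mulHom.{u} a = mulHom a := fun k a => by
    rcases neg_one_pow_eq_or ℤ k with hk | hk <;> rw [hk]
    · rw [one_smul]
    · rw [neg_one_smul]
      ext r
      exact ZMod.neg_eq_self_mod_two _
  have h' : ∀ a b : ZMod 2, mulHom.{u} (a + b) = mulHom a + mulHom b := fun a b => by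
    ext r
    exact mul_add _ _ _
  simp only [h]
  exact (map_sum (⟨⟨mulHom, mulHom_zero⟩, h'⟩ : ZMod 2 →+ _) a Finset.univ).symm

/-- The boundary of the standard simplex has nontrivial homology in the top dimension. -/
theorem not_isZero_singularHomologyInt_of_homeomorph (T : TopCat.{u}) (n : ℕ)
    (h : T ≃ₜ {x : stdSimplex ℝ (Fin (n + 2)) // ∃ i, x i = 0}) :
    ¬ Limits.IsZero ((singularHomologyInt n).obj T) := by
  intro hzero
  set C := singularChainsInt.obj T
  let g : C(T, stdSimplex ℝ (Fin (n + 2))) := ⟨fun t => (h t).1, continuous_subtype_val.comp h.continuous⟩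
  have hg : ∀ t, ∃ i, g t i = 0 := fun t => (h t).2
  let lab : T → ℕ := fun t => (argmax (g t) : ℕ)
  -- This cochain counts the fully labelled simplices in the `k`-th subdivision of a singular
  -- simplex.
  let θ : ∀ k q : ℕ, (singularChainsInt.obj T).X q ⟶ AddCommGrpCat.of (ULift.{u} (ZMod 2)) :=
    fun k q => singularChainsDesc fun s =>
      mulHom (count (extend fun x => lab (s x)) q ((sd _ q ^ k) (idChain q)))
  -- the faces of the simplex
  have hface : ∀ (i : Fin (n + 2)) (x : stdSimplex ℝ (Fin (n + 1))),
      ∃ j, stdSimplex.map i.succAbove x j = 0 := fun i x => by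
    refine ⟨i, ?_⟩
    rw [stdSimplex.map_coe, FunOnFinite.linearMap_apply_apply]
    refine Finset.sum_eq_zero fun a ha => ?_
    exact absurd (Finset.mem_filter.1 ha).2 (Fin.succAbove_ne i a)
  let face : Fin (n + 2) → C(stdSimplex ℝ (Fin (n + 1)), T) := fun i =>
    ⟨fun x => h.symm ⟨stdSimplex.map i.succAbove x, hface i x⟩,
      h.symm.continuous.comp ((stdSimplex.continuous_map _).subtype_mk _)⟩
  have hgface : ∀ i x, g (face i x) = stdSimplex.map i.succAbove x := fun i x =>
    congrArg Subtype.val (h.apply_symm_apply _)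
  let z : AddCommGrpCat.of (ULift.{u} ℤ) ⟶ C.X n :=
    ∑ i : Fin (n + 2), (-1) ^ i.val • singularChain (face i)
  -- the sum of the faces is a cycle
  set m := (ComplexShape.down ℕ).next n with hm
  have hz : z ≫ C.d n m = 0 := by
    -- In the full simplex, `z` becomes the boundary of the identity simplex; injectivity on chains
    -- pulls the cycle condition back to `T`.
    let U : TopCat.{u} := TopCat.of (ULift.{u} (stdSimplex ℝ (Fin (n + 2))))
    let j : T ⟶ U := TopCat.ofHom ⟨fun t => ⟨g t⟩, continuous_uliftUp.comp g.continuous⟩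
    have hj : Function.Injective j := fun a b hab =>
      h.injective (Subtype.ext (congrArg ULift.down hab))
    have : Mono ((singularChainsInt.map j).f m) :=
      (AddCommGrpCat.mono_iff_injective _).2 (singularChains_map_injective j hj m)
    rw [← cancel_mono ((singularChainsInt.map j).f m), Category.assoc,
      ← (singularChainsInt.map j).comm, ← Category.assoc]
    have hzj : z ≫ (singularChainsInt.map j).f n =
        singularChain (T := U) ⟨ULift.up, continuous_uliftUp⟩ ≫
          (singularChainsInt.obj U).d (n + 1) n := by
      rw [singularChain_d, Preadditive.sum_comp]
      refine Finset.sum_congr rfl fun i _ => ?_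
      rw [Preadditive.zsmul_comp, singularChain_map]
      congr 2
      ext x : 1
      exact congrArg ULift.up (hgface i x)
    rw [hzj, Category.assoc, HomologicalComplex.d_comp_d, Limits.comp_zero, Limits.zero_comp]
  -- its value under the functionals `θ`
  have hθz : ∀ k, z ≫ θ k n = mulHom 1 := fun k => by
    rw [Preadditive.sum_comp]
    simp only [Preadditive.zsmul_comp, θ, singularChain_desc]
    rw [sum_neg_one_pow_smul_mulHom]
    congr 1
    simp only [lab, hgface]
    rw [sum_count_faces (fun x => (argmax x : ℕ)) k,
      count_boundary_sd_pow _ (fun x => Nat.le_of_lt_succ (Fin.is_lt _)),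
      ← count_sd_pow_stdSimplex (n + 1) k argmax fun x hx => ?_]
    · refine count_congr (fun w hw => ?_) (sd_pow_stdSimplex_mem (n + 1) k)
      funext i
      exact extend_of_mem _ (hw.1 i)
    · refine ((by positivity : (0 : ℝ) < ((n + 1 : ℕ) + 1 : ℝ)⁻¹).trans_le (le_argmax hx)).ne'
  -- the functionals eventually vanish on each boundary
  have hθd : ∀ w : C.X (n + 1), ∃ k₀, ∀ k ≥ k₀, (C.d (n + 1) n ≫ θ k n) w = 0 := by
    intro w
    let S : AddSubgroup (C.X (n + 1)) :=
      { carrier := {w | ∃ k₀, ∀ k ≥ k₀, (C.d (n + 1) n ≫ θ k n) w = 0}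
        zero_mem' := ⟨0, fun k _ => map_zero _⟩
        add_mem' := by
          rintro a b ⟨k₁, h₁⟩ ⟨k₂, h₂⟩
          refine ⟨max k₁ k₂, fun k hk => ?_⟩
          rw [map_add, h₁ k (le_of_max_le_left hk), h₂ k (le_of_max_le_right hk), add_zero]
        neg_mem' := by
          rintro a ⟨k₁, h₁⟩
          refine ⟨k₁, fun k hk => ?_⟩
          rw [map_neg, h₁ k hk, neg_zero] }
    refine singularChains_induction S (fun s r => ?_) w
    obtain ⟨k₀, hk₀⟩ := eventually_count_eq_zero (g.comp s) fun x => hg (s x)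
    refine ⟨k₀, fun k hk => ?_⟩
    have : singularChain s ≫ C.d (n + 1) n ≫ θ k n = 0 := by
      rw [← Category.assoc, singularChain_d, Preadditive.sum_comp]
      simp only [Preadditive.zsmul_comp, θ, singularChain_desc]
      rw [sum_neg_one_pow_smul_mulHom]
      have h1 := (sum_count_faces (fun x => lab (s x)) k).trans
        ((count_boundary_sd_pow _ (fun x => Nat.le_of_lt_succ (Fin.is_lt _)) k).trans (hk₀ k hk))
      rw [← mulHom_zero, ← h1]
      rfl
    exact ConcreteCategory.congr_hom this r
  have hex := (HomologicalComplex.exactAt_iff_isZero_homology _ _).2 hzero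
  rw [HomologicalComplex.exactAt_iff' _ (n + 1) n m (by simp) rfl, ShortComplex.ab_exact_iff] at hex
  -- The level `k` must be chosen after `w`: no single `θ k` need vanish on all boundaries.
  obtain ⟨w, hw⟩ := hex (z ⟨1⟩) (ConcreteCategory.congr_hom hz _)
  obtain ⟨k, hk⟩ := hθd w
  have h1 : (z ≫ θ k n) ⟨1⟩ = 0 := by
    refine Eq.trans ?_ (hk k le_rfl)
    exact congrArg (θ k n) hw.symm
  rw [hθz] at h1
  have h2 : ((1 : ℤ) : ZMod 2) * 1 = 0 := congrArg ULift.down h1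
  simp at h2

/-! ### Hereditary equivalences and compact images. -/

/-- The image of `c` has a compact carrier inside `f '' M`. A carrier missing `f p` would lie in `f
'' (M \ {p})`, and naturality would then make `c` come from `M \ {p}`. So the carrier is all of `f
'' M`. -/
theorem IsHereditaryEquivalence.isCompact_image_of_forall_notMem_range {X Y : Type u}
    [TopologicalSpace X] [TopologicalSpace Y] {n : ℕ} {f : X → Y}
    (hf : IsHereditaryEquivalence (singularHomologyInt.{u} n) f) {M : Set X}
    (c : (singularHomologyInt.{u} n).obj (TopCat.of M))
    (hc : ∀ p ∈ M, c ∉ Set.range ((singularHomologyInt n).map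
      (subspaceInclusion (Set.sdiff_subset : M \ {p} ⊆ M)))) : IsCompact (f '' M) := by
  obtain ⟨hbij, φ, hφ⟩ := hf
  obtain ⟨K, hK, hKc, c', hc'⟩ := singularHomologyInt_exists_isCompact (f '' M) n ((φ M).hom c)
  suffices h : K = f '' M from h ▸ hKc
  refine hK.antisymm ?_
  rintro _ ⟨p, hp, rfl⟩
  by_contra hpK
  refine hc p hp ?_
  have hsub : K ⊆ f '' (M \ {p}) := by
    intro y hy
    obtain ⟨x, hx, rfl⟩ := hK hy
    exact ⟨x, ⟨hx, fun h => hpK (h ▸ hy)⟩, rfl⟩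
  refine ⟨(φ (M \ {p})).inv ((singularHomologyInt n).map (subspaceInclusion hsub) c'), ?_⟩
  have h1 : (singularHomologyInt n).map (subspaceInclusion (Set.sdiff_subset : M \ {p} ⊆ M)) =
      (φ (M \ {p})).hom ≫ (singularHomologyInt n).map (subspaceInclusion
        (Set.image_mono (f := f) Set.sdiff_subset)) ≫ (φ M).inv := by
    rw [← Category.assoc, ← hφ, Category.assoc, Iso.hom_inv_id, Category.comp_id]
  have h2 : (φ (M \ {p})).inv ≫ (singularHomologyInt n).map (subspaceInclusion
      (Set.sdiff_subset : M \ {p} ⊆ M)) = (singularHomologyInt n).map (subspaceInclusion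
        (Set.image_mono (f := f) Set.sdiff_subset)) ≫ (φ M).inv := by
    rw [h1, Iso.inv_hom_id_assoc]
  have h3 : (singularHomologyInt n).map (subspaceInclusion hsub) ≫
      (singularHomologyInt n).map (subspaceInclusion
        (Set.image_mono (f := f) Set.sdiff_subset)) =
      (singularHomologyInt n).map (subspaceInclusion hK) := by
    rw [← Functor.map_comp, subspaceInclusion_comp]
  have h4 := ConcreteCategory.congr_hom h2
    ((singularHomologyInt n).map (subspaceInclusion hsub) c')
  have h5 := ConcreteCategory.congr_hom h3 c'
  have h6 := ConcreteCategory.congr_hom (φ M).hom_inv_id c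
  rw [ConcreteCategory.comp_apply, ConcreteCategory.comp_apply] at h4
  rw [ConcreteCategory.comp_apply] at h5 h6
  rw [h4, h5, hc']
  exact h6

/-! ### Homeomorphisms between cubes, simplices and spheres. -/

lemma notMem_interior_of_forall_add_smul {E : Type*} [AddCommGroup E] [Module ℝ E]
    [TopologicalSpace E] [ContinuousAdd E] [ContinuousSMul ℝ E] {s : Set E} {x : E} (d : E)
    (h : ∀ t : ℝ, 0 < t → x + t • d ∉ s) : x ∉ interior s := by
  intro hx
  have hc : Continuous fun t : ℝ => x + t • d := by fun_prop
  have h1 : ∀ᶠ t : ℝ in nhds 0, x + t • d ∈ s := by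
    have : Filter.Tendsto (fun t : ℝ => x + t • d) (nhds 0) (nhds x) := by
      simpa using hc.tendsto 0
    exact this (mem_interior_iff_mem_nhds.1 hx)
  obtain ⟨t, ht, ht'⟩ := ((h1.filter_mono nhdsWithin_le_nhds).and
    (self_mem_nhdsWithin (s := Set.Ioi (0 : ℝ)))).exists
  exact h t ht' ht

/-- The simplex spanned by the origin and the standard basis vectors. -/
def cornerSimplex (k : ℕ) : Set (Fin k → ℝ) := {x | (∀ i, 0 ≤ x i) ∧ ∑ i, x i ≤ 1}

lemma convex_cornerSimplex (k : ℕ) : Convex ℝ (cornerSimplex k) := by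
  rintro x ⟨hx, hx'⟩ y ⟨hy, hy'⟩ a b ha hb hab
  refine ⟨fun i => by simpa using add_nonneg (mul_nonneg ha (hx i)) (mul_nonneg hb (hy i)), ?_⟩
  simp only [Pi.add_apply, Pi.smul_apply, smul_eq_mul, Finset.sum_add_distrib, ← Finset.mul_sum]
  nlinarith

lemma isClosed_cornerSimplex (k : ℕ) : IsClosed (cornerSimplex k) := by
  have h : IsClosed {x : Fin k → ℝ | ∑ i, x i ≤ 1} := isClosed_le (by fun_prop) continuous_const
  have h0 : IsClosed {x : Fin k → ℝ | ∀ i, 0 ≤ x i} := by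
    simp only [Set.ofPred_forall]
    exact isClosed_iInter fun i => isClosed_le continuous_const (continuous_apply i)
  exact h0.inter h

lemma isBounded_cornerSimplex (k : ℕ) : Bornology.IsBounded (cornerSimplex k) := by
  refine (Metric.isBounded_Icc (0 : Fin k → ℝ) 1).subset fun x hx => ⟨hx.1, fun i => ?_⟩
  exact (Finset.single_le_sum (fun j _ => hx.1 j) (Finset.mem_univ i)).trans hx.2

lemma mem_interior_cornerSimplex {k : ℕ} {x : Fin k → ℝ} (h0 : ∀ i, 0 < x i)
    (h1 : ∑ i, x i < 1) : x ∈ interior (cornerSimplex k) := by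
  have h : IsOpen {x : Fin k → ℝ | ∑ i, x i < 1} := isOpen_lt (by fun_prop) continuous_const
  have h' : IsOpen {x : Fin k → ℝ | ∀ i, 0 < x i} := by
    simp only [Set.ofPred_forall]
    exact isOpen_iInter_of_finite fun i => isOpen_lt continuous_const (continuous_apply i)
  refine mem_interior.2 ⟨{x | (∀ i, 0 < x i) ∧ ∑ i, x i < 1}, fun y hy =>
    ⟨fun i => (hy.1 i).le, hy.2.le⟩, h'.inter h,
    h0, h1⟩

lemma interior_cornerSimplex_nonempty (k : ℕ) : (interior (cornerSimplex k)).Nonempty := by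
  have hk : (0 : ℝ) < k + 1 := by positivity
  refine ⟨fun _ => (k + 1 : ℝ)⁻¹, mem_interior_cornerSimplex (fun _ => by positivity) ?_⟩
  rw [Finset.sum_const, Finset.card_univ, Fintype.card_fin, nsmul_eq_mul, ← div_eq_mul_inv,
    div_lt_one hk]
  linarith

lemma mem_frontier_cornerSimplex {k : ℕ} (hk : k ≠ 0) {x : Fin k → ℝ} :
    x ∈ frontier (cornerSimplex k) ↔
      x ∈ cornerSimplex k ∧ ((∃ i, x i = 0) ∨ ∑ i, x i = 1) := by
  rw [(isClosed_cornerSimplex k).frontier_eq, Set.mem_sdiff]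
  refine and_congr_right fun hx => ⟨fun h => ?_, ?_⟩
  · by_contra! h'
    exact h (mem_interior_cornerSimplex (fun i => (hx.1 i).lt_of_ne' (h'.1 i))
      (hx.2.lt_of_ne h'.2))
  · rintro (⟨i, hi⟩ | h)
    · refine notMem_interior_of_forall_add_smul (-Pi.single i 1) fun t ht hmem => ?_
      have := hmem.1 i
      simp [hi] at this
      linarith
    · refine notMem_interior_of_forall_add_smul 1 fun t ht hmem => ?_
      have := hmem.2
      simp only [Pi.add_apply, Pi.smul_apply, Pi.one_apply, smul_eq_mul, mul_one,
        Finset.sum_add_distrib, h, Finset.sum_const, Finset.card_univ, Fintype.card_fin,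
        nsmul_eq_mul] at this
      have : 0 < (k : ℝ) * t := mul_pos (by positivity) ht
      linarith

lemma frontier_Icc_pi {k : ℕ} {x : Fin k → ℝ} :
    x ∈ frontier (Set.Icc (0 : Fin k → ℝ) 1) ↔
      x ∈ Set.Icc (0 : Fin k → ℝ) 1 ∧ ∃ i, x i = 0 ∨ x i = 1 := by
  rw [isClosed_Icc.frontier_eq, Set.mem_sdiff]
  refine and_congr_right fun hx => ?_
  rw [← Set.pi_univ_Icc, interior_pi_set Set.finite_univ]
  simp only [interior_Icc, Set.mem_univ_pi, Set.mem_Ioo, Pi.zero_apply, Pi.one_apply, not_forall,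
    not_and_or, not_lt]
  refine exists_congr fun i => or_congr ⟨fun h => le_antisymm h (hx.1 i), fun h => h.le⟩
    ⟨fun h => le_antisymm (hx.2 i) h, fun h => h.ge⟩

lemma interior_Icc_pi_nonempty (k : ℕ) : (interior (Set.Icc (0 : Fin k → ℝ) 1)).Nonempty := by
  rw [← Set.pi_univ_Icc, interior_pi_set Set.finite_univ]
  refine ⟨fun _ => 1 / 2, fun i _ => ?_⟩
  simp only [Pi.zero_apply, Pi.one_apply, interior_Icc, Set.mem_Ioo]
  norm_num

lemma Homeomorph.nonempty_of_image_eq {X Y : Type*} [TopologicalSpace X] [TopologicalSpace Y]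
    (e : X ≃ₜ Y) {s : Set X} {t : Set Y} (h : e '' s = t) : Nonempty (s ≃ₜ t) :=
  ⟨(e.image s).trans (Homeomorph.setCongr h)⟩

/-- The simplex as a subset of the vector space of the same dimension. -/
noncomputable def stdSimplexHomeomorphCorner (k : ℕ) :
    stdSimplex ℝ (Fin (k + 1)) ≃ₜ cornerSimplex k where
  toFun x := ⟨fun i => x i.succ, fun i => x.2.1 _, by
    have h := stdSimplex.sum_eq_one x
    rw [Fin.sum_univ_succ] at h
    linarith [x.2.1 0, show x 0 = x.1 0 from rfl]⟩
  invFun y := ⟨Fin.cons (1 - ∑ i, y.1 i) y.1,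
    fun i => Fin.cases (sub_nonneg.2 y.2.2) (fun i => y.2.1 i) i,
    by simp [Fin.sum_univ_succ]⟩
  left_inv x := by
    have h := stdSimplex.sum_eq_one x
    rw [Fin.sum_univ_succ] at h
    refine Subtype.ext (funext fun i => Fin.cases ?_ (fun i => ?_) i)
    · simp only [Fin.cons_zero]
      linarith [show x 0 = x.1 0 from rfl]
    · simp only [Fin.cons_succ]
      rfl
  right_inv y := by
    refine Subtype.ext (funext fun i => ?_)
    exact Fin.cons_succ (α := fun _ => ℝ) (1 - ∑ i, y.1 i) y.1 i
  continuous_toFun := by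
    refine Continuous.subtype_mk (continuous_pi fun i => ?_) _
    exact (continuous_apply i.succ).comp continuous_subtype_val
  continuous_invFun := by
    refine Continuous.subtype_mk (continuous_pi fun i => ?_) _
    refine Fin.cases ?_ (fun i => ?_) i
    · simp only [Fin.cons_zero]
      fun_prop
    · simp only [Fin.cons_succ]
      exact (continuous_apply i).comp continuous_subtype_val

/-- The cube as a subset of the vector space of the same dimension. -/
noncomputable def cubeHomeomorphIcc (k : ℕ) : (Fin k → I) ≃ₜ Set.Icc (0 : Fin k → ℝ) 1 where
  toFun x := ⟨fun i => x i, fun i => (x i).2.1, fun i => (x i).2.2⟩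
  invFun y i := ⟨y.1 i, y.2.1 i, y.2.2 i⟩
  left_inv _ := rfl
  right_inv _ := rfl
  continuous_toFun := by fun_prop
  continuous_invFun := by
    refine continuous_pi fun i => Continuous.subtype_mk ?_ _
    exact (continuous_apply i).comp continuous_subtype_val

lemma nonempty_homeomorph_subtype {X E : Type*} [TopologicalSpace X] [TopologicalSpace E]
    {s t : Set E} (e : X ≃ₜ s) {p : X → Prop} (h : ∀ x, p x ↔ (e x : E) ∈ t) (hts : t ⊆ s) :
    Nonempty ({x // p x} ≃ₜ t) :=
  ⟨{ toFun := fun x => ⟨e x, (h x).1 x.2⟩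
     invFun := fun y => ⟨e.symm ⟨y, hts y.2⟩, (h _).2 (by simp)⟩
     left_inv := fun x => by simp
     right_inv := fun y => by simp
     continuous_toFun := by fun_prop
     continuous_invFun := by
      refine Continuous.subtype_mk (e.symm.continuous.comp ?_) _
      exact continuous_subtype_val.subtype_mk _ }⟩

lemma nonempty_cube_homeomorph_stdSimplex (k : ℕ) :
    Nonempty ((Fin k → I) ≃ₜ stdSimplex ℝ (Fin (k + 1))) := by
  obtain ⟨e, -, he, -⟩ := exists_homeomorph_image_eq (convex_Icc (0 : Fin k → ℝ) 1)
    (interior_Icc_pi_nonempty k) (NormedSpace.isVonNBounded_of_isBounded ℝ (Metric.isBounded_Icc _ _))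
    (convex_cornerSimplex k) (interior_cornerSimplex_nonempty k)
    (NormedSpace.isVonNBounded_of_isBounded ℝ (isBounded_cornerSimplex k))
  rw [isClosed_Icc.closure_eq, (isClosed_cornerSimplex k).closure_eq] at he
  obtain ⟨e'⟩ := e.nonempty_of_image_eq he
  exact ⟨((cubeHomeomorphIcc k).trans e').trans (stdSimplexHomeomorphCorner k).symm⟩

lemma nonempty_cubeBoundary_homeomorph_frontier (k : ℕ) :
    Nonempty (Cube.boundary (Fin k) ≃ₜ frontier (Set.Icc (0 : Fin k → ℝ) 1)) := by
  refine nonempty_homeomorph_subtype (cubeHomeomorphIcc k) (fun x => ?_) isClosed_Icc.frontier_subset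
  rw [frontier_Icc_pi]
  refine ⟨fun h => ⟨((cubeHomeomorphIcc k) x).2, ?_⟩, fun h => ?_⟩
  · obtain ⟨i, hi⟩ := h
    exact ⟨i, hi.imp (congrArg Subtype.val) (congrArg Subtype.val)⟩
  · obtain ⟨-, i, hi⟩ := h
    exact ⟨i, hi.imp (fun h => Subtype.ext h) (fun h => Subtype.ext h)⟩

/-- Both are frontiers of bounded convex sets with nonempty interior in the same space, and a
homeomorphism of that space matches the frontiers. -/
lemma nonempty_cubeBoundary_homeomorph_simplexBoundary (n : ℕ) :
    Nonempty (Cube.boundary (Fin (n + 1)) ≃ₜ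
      {x : stdSimplex ℝ (Fin (n + 2)) // ∃ i, x i = 0}) := by
  obtain ⟨e, -, -, he⟩ := exists_homeomorph_image_eq (convex_Icc (0 : Fin (n + 1) → ℝ) 1)
    (interior_Icc_pi_nonempty _) (NormedSpace.isVonNBounded_of_isBounded ℝ (Metric.isBounded_Icc _ _))
    (convex_cornerSimplex _) (interior_cornerSimplex_nonempty _)
    (NormedSpace.isVonNBounded_of_isBounded ℝ (isBounded_cornerSimplex _))
  obtain ⟨e₁⟩ := nonempty_cubeBoundary_homeomorph_frontier (n + 1)
  obtain ⟨e₂⟩ := e.nonempty_of_image_eq he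
  obtain ⟨e₃⟩ : Nonempty ({x : stdSimplex ℝ (Fin (n + 2)) // ∃ i, x i = 0} ≃ₜ
      frontier (cornerSimplex (n + 1))) := by
    refine nonempty_homeomorph_subtype (stdSimplexHomeomorphCorner (n + 1)) (fun x => ?_)
      (isClosed_cornerSimplex _).frontier_subset
    rw [mem_frontier_cornerSimplex n.succ_ne_zero, and_iff_right (Subtype.coe_prop _),
      Fin.exists_fin_succ, or_comm]
    refine or_congr Iff.rfl ?_
    have h := stdSimplex.sum_eq_one x
    rw [Fin.sum_univ_succ] at h
    have h' : ∑ i, ((stdSimplexHomeomorphCorner (n + 1)) x : Fin (n + 1) → ℝ) i =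
      ∑ i : Fin (n + 1), x i.succ := rfl
    rw [h']
    constructor <;> intro h'' <;> linarith
  exact ⟨(e₁.trans e₂).trans e₃.symm⟩

lemma nonempty_cubeBoundary_homeomorph_sphere (k : ℕ) :
    Nonempty (Cube.boundary (Fin k) ≃ₜ Metric.sphere (0 : EuclideanSpace ℝ (Fin k)) 1) := by
  let L := EuclideanSpace.equiv (Fin k) ℝ
  let s : Set (EuclideanSpace ℝ (Fin k)) := L ⁻¹' Set.Icc 0 1
  have hs : s = L.symm '' Set.Icc 0 1 := by
    ext x
    simp [s, ContinuousLinearEquiv.image_eq_preimage_symm]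
  obtain ⟨e, -, -, he⟩ := exists_homeomorph_image_interior_closure_frontier_eq_unitBall
    (s := s) ((convex_Icc _ _).linear_preimage (L : EuclideanSpace ℝ (Fin k) →ₗ[ℝ] Fin k → ℝ))
    (by
      rw [show s = L.toHomeomorph ⁻¹' Set.Icc 0 1 from rfl, ← L.toHomeomorph.preimage_interior]
      exact (interior_Icc_pi_nonempty k).preimage L.surjective)
    (by
      rw [hs]
      exact (isCompact_Icc.image L.symm.continuous).isBounded)
  obtain ⟨e₁⟩ := nonempty_cubeBoundary_homeomorph_frontier k
  obtain ⟨e₂⟩ := e.nonempty_of_image_eq he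
  obtain ⟨e₃⟩ := L.toHomeomorph.symm.nonempty_of_image_eq
    (s := frontier (Set.Icc (0 : Fin k → ℝ) 1)) (t := frontier s) (by
      rw [L.toHomeomorph.symm.image_frontier, hs]
      rfl)
  exact ⟨(e₁.trans e₃).trans e₂⟩

lemma contractibleSpace_compl_singleton {E : Type*} [NormedAddCommGroup E] [InnerProductSpace ℝ E]
    (v : Metric.sphere (0 : E) 1) : ContractibleSpace ({v}ᶜ : Set (Metric.sphere (0 : E) 1)) :=
  have e : ({v}ᶜ : Set (Metric.sphere (0 : E) 1)) ≃ₜ (Set.univ : Set (ℝ ∙ (v : E))ᗮ) :=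
    (stereographic (norm_eq_of_mem_sphere v)).toHomeomorphSourceTarget
  (e.trans (Homeomorph.Set.univ _)).contractibleSpace

lemma contractibleSpace_sdiff_singleton {X S : Type*} [TopologicalSpace X] [TopologicalSpace S]
    {M : Set X} (h : M ≃ₜ S) (hS : ∀ v : S, ContractibleSpace ({v}ᶜ : Set S)) {p : X}
    (hp : p ∈ M) : ContractibleSpace (M \ {p} : Set X) := by
  let e : (M \ {p} : Set X) ≃ₜ ({h ⟨p, hp⟩}ᶜ : Set S) :=
    { toFun := fun x => ⟨h ⟨x, x.2.1⟩, fun hx => x.2.2 (congrArg Subtype.val (h.injective hx))⟩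
      invFun := fun y => ⟨h.symm y, (h.symm y).2, fun hy => y.2 (by
        have : h.symm y = ⟨p, hp⟩ := Subtype.ext hy
        exact (h.apply_symm_apply _).symm.trans (congrArg h this))⟩
      left_inv := fun x => by simp
      right_inv := fun y => by simp
      continuous_toFun := by
        refine Continuous.subtype_mk (h.continuous.comp ?_) _
        exact continuous_subtype_val.subtype_mk _
      continuous_invFun := by fun_prop }
  have := hS (h ⟨p, hp⟩)
  exact e.contractibleSpace

/-- A hereditary equivalence with respect to the homology in dimension `n` maps topological
spheres of dimension `n` onto compact sets. -/
theorem IsHereditaryEquivalence.isCompact_image_sphere {X Y : Type u} [TopologicalSpace X]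
    [TopologicalSpace Y] {n : ℕ} (hn : n ≠ 0) {f : X → Y}
    (hf : IsHereditaryEquivalence (singularHomologyInt.{u} n) f) {M : Set X}
    (h : M ≃ₜ Cube.boundary (Fin (n + 1))) : IsCompact (f '' M) := by
  obtain ⟨e₁⟩ := nonempty_cubeBoundary_homeomorph_simplexBoundary n
  obtain ⟨e₂⟩ := nonempty_cubeBoundary_homeomorph_sphere (n + 1)
  have h1 := not_isZero_singularHomologyInt_of_homeomorph (TopCat.of M) n (h.trans e₁)
  obtain ⟨c, hc⟩ : ∃ c : (singularHomologyInt.{u} n).obj (TopCat.of M), c ≠ 0 := by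
    by_contra! hc
    refine h1 ((Limits.IsZero.iff_id_eq_zero _).2 ?_)
    ext c
    exact hc c
  refine hf.isCompact_image_of_forall_notMem_range c fun p hp => ?_
  rintro ⟨c', rfl⟩
  have := contractibleSpace_sdiff_singleton (h.trans e₂) contractibleSpace_compl_singleton hp
  have h2 := singularHomologyInt_isZero_of_contractible (TopCat.of (M \ {p} : Set X)) hn
  refine hc ?_
  rw [h2.eq_of_src ((singularHomologyInt n).map _) 0]
  rfl

/-! ### Spheres through graphs of sections. -/

/-- The points of the cube obtained from the points `G b` of the graph of a section by moving
the `j`-th coordinate towards `1`. -/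
noncomputable def graphShift {n m : ℕ} (G : C(Fin n → I, Fin m → I)) (j : Fin m) (η : I)
    (x : Fin (n + 1) → I) : Fin m → I :=
  Function.update (G (Fin.tail x)) j
    (unitInterval.symm (unitInterval.symm (G (Fin.tail x) j) * unitInterval.symm (η * x 0)))

section GraphShift

variable {n m : ℕ} {G : C(Fin n → I, Fin m → I)} {j : Fin m} {η : I} {s : Fin n → Fin m}

lemma continuous_graphShift : Continuous (graphShift G j η) := by
  have ht : Continuous fun x : Fin (n + 1) → I => G (Fin.tail x) :=
    G.continuous.comp (continuous_pi fun i => continuous_apply _)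
  refine ht.update j (unitInterval.continuous_symm.comp ?_)
  exact (unitInterval.continuous_symm.comp ((continuous_apply j).comp ht)).mul
    (unitInterval.continuous_symm.comp (continuous_const.mul (continuous_apply 0)))

lemma graphShift_cons_zero (b : Fin n → I) :
    graphShift G j η (Fin.cons 0 b : Fin (n + 1) → I) = G b := by
  simp [graphShift]

lemma graphShift_apply_of_ne (x : Fin (n + 1) → I) {l : Fin m} (hl : l ≠ j) :
    graphShift G j η x l = G (Fin.tail x) l :=
  Function.update_of_ne hl _ _

lemma coe_graphShift_apply (x : Fin (n + 1) → I) :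
    (graphShift G j η x j : ℝ) =
      1 - (1 - (G (Fin.tail x) j : ℝ)) * (1 - (η : ℝ) * (x 0 : ℝ)) := by
  simp [graphShift]

lemma graphShift_apply_section (hG : ∀ b k, G b (s k) = b k) (hj : ∀ k, s k ≠ j)
    (x : Fin (n + 1) → I) : (fun k => graphShift G j η x (s k)) = Fin.tail x :=
  funext fun k => by rw [graphShift_apply_of_ne x (hj k), hG]

/-- The section coordinates recover the tail of `x`. Over a fixed tail, coordinate `j` is affine in
`x 0` with slope `(1 - G_j) * η`, nonzero because the graph stays below `1`. -/
lemma graphShift_injective (hG : ∀ b k, G b (s k) = b k) (hj : ∀ k, s k ≠ j)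
    (hG1 : ∀ b, (G b j : ℝ) < 1) (hη : (0 : ℝ) < η) : Function.Injective (graphShift G j η) := by
  intro x y hxy
  have h1 : Fin.tail x = Fin.tail y := by
    rw [← graphShift_apply_section (η := η) hG hj x, hxy, graphShift_apply_section hG hj]
  have h2 := congrArg (fun z : Fin m → I => (z j : ℝ)) hxy
  simp only [coe_graphShift_apply, h1] at h2
  have h3 : (1 - (G (Fin.tail y) j : ℝ)) * η * ((x 0 : ℝ) - y 0) = 0 := by linarith
  have h4 : (1 - (G (Fin.tail y) j : ℝ)) * η ≠ 0 :=
    mul_ne_zero (sub_pos.2 (hG1 _)).ne' hη.ne'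
  have h5 : x 0 = y 0 :=
    Subtype.ext (sub_eq_zero.1 ((mul_eq_zero.1 h3).resolve_left h4))
  rw [← Fin.cons_self_tail x, ← Fin.cons_self_tail y, h1, h5]

end GraphShift

/-- A closed subset of a cube which is mapped injectively by a projection extends to
a section of the projection. -/
lemma exists_section {n m : ℕ} {s : Fin n → Fin m} (hs : Function.Injective s) {j : Fin m}
    (hj : ∀ k, s k ≠ j) {K : Set (Fin m → I)} (hK : IsClosed K)
    (hinj : Set.InjOn (fun (x : Fin m → I) k => x (s k)) K) (hK1 : ∀ x ∈ K, (x j : ℝ) < 1) :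
    ∃ G : C(Fin n → I, Fin m → I), (∀ b k, G b (s k) = b k) ∧ (∀ b, (G b j : ℝ) < 1) ∧
      ∀ x ∈ K, G (fun k => x (s k)) = x := by
  classical
  have : CompactSpace K := isCompact_iff_compactSpace.1 hK.isCompact
  have he : Topology.IsClosedEmbedding fun (x : K) k => x.1 (s k) :=
    Continuous.isClosedEmbedding
      (continuous_pi fun k => (continuous_apply _).comp continuous_subtype_val)
      fun x y hxy => Subtype.ext (hinj x.2 y.2 hxy)
  have hext : ∀ l : Fin m, ∃ g : C(Fin n → I, I), (l = j → ∀ b, (g b : ℝ) < 1) ∧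
      ∀ x ∈ K, g (fun k => x (s k)) = x l := by
    intro l
    -- An interval, half-open exactly for `l = j`, so that Tietze preserves the strict bound needed
    -- to thicken the graph.
    let t : Set ℝ := {r | r ∈ Set.Icc (0 : ℝ) 1 ∧ (l = j → r < 1)}
    have ht : t.OrdConnected := ⟨fun a ha b hb r hr =>
      ⟨⟨ha.1.1.trans hr.1, hr.2.trans hb.1.2⟩, fun h => hr.2.trans_lt (hb.2 h)⟩⟩
    obtain ⟨g, hg, hg'⟩ := ContinuousMap.exists_extension_forall_mem_of_isClosedEmbedding
      (⟨fun x : K => (x.1 l : ℝ), continuous_subtype_val.comp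
        ((continuous_apply l).comp continuous_subtype_val)⟩ : C(K, ℝ)) (t := t)
      (fun x => ⟨(x.1 l).2, fun h => h ▸ hK1 x x.2⟩)
      ⟨0, ⟨le_rfl, zero_le_one⟩, fun _ => zero_lt_one⟩ he
    refine ⟨⟨fun b => ⟨g b, (hg b).1⟩, g.continuous.subtype_mk _⟩, fun h b => (hg b).2 h,
      fun x hx => Subtype.ext (congrFun hg' ⟨x, hx⟩)⟩
  choose g hg1 hg using hext
  refine ⟨⟨fun b l => if h : ∃ k, s k = l then b h.choose else g l b, ?_⟩, ?_, ?_, ?_⟩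
  · refine continuous_pi fun l => ?_
    by_cases h : ∃ k, s k = l
    · simp only [dif_pos h]
      exact continuous_apply _
    · simp only [dif_neg h]
      exact (g l).continuous
  · intro b k
    have h : ∃ k', s k' = s k := ⟨k, rfl⟩
    simp only [ContinuousMap.coe_mk, dif_pos h]
    rw [hs h.choose_spec]
  · intro b
    have h : ¬ ∃ k, s k = j := fun ⟨k, hk⟩ => hj k hk
    simp only [ContinuousMap.coe_mk, dif_neg h]
    exact hg1 j rfl b
  · intro x hx
    funext l
    by_cases h : ∃ k, s k = l
    · simp only [ContinuousMap.coe_mk, dif_pos h]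
      rw [h.choose_spec]
    · simp only [ContinuousMap.coe_mk, dif_neg h]
      exact hg l x hx

/-- A map on a cube maps the topological spheres of dimension `n` onto compact sets. -/
def MapsSpheresToCompacts {m : ℕ} {Y : Type*} [TopologicalSpace Y] (n : ℕ)
    (g : (Fin m → I) → Y) : Prop :=
  ∀ Φ : Cube.boundary (Fin (n + 1)) → Fin m → I, Continuous Φ → Function.Injective Φ →
    IsCompact (g '' Set.range Φ)

/-! ### Continuity of maps of cubes that send spheres to compact sets. -/

section MapsSpheres

variable {n m : ℕ} {Y : Type*} [TopologicalSpace Y] {g : (Fin m → I) → Y}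

/-- The boundary of the thickened graph is an `n`-sphere, and its face `x 0 = 0` is the graph
itself, which contains `K`. -/
lemma exists_superset_isCompact_image (hg : MapsSpheresToCompacts n g) {s : Fin n → Fin m}
    {j : Fin m} (hj : ∀ k, s k ≠ j) {K : Set (Fin m → I)} {G : C(Fin n → I, Fin m → I)}
    (hG : ∀ b k, G b (s k) = b k) (hG1 : ∀ b, (G b j : ℝ) < 1)
    (hGK : ∀ x ∈ K, G (fun k => x (s k)) = x) {η : I} (hη : (0 : ℝ) < η) :
    ∃ A, K ⊆ A ∧ A ⊆ Set.range (graphShift G j η) ∧ IsCompact (g '' A) := by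
  refine ⟨Set.range fun x : Cube.boundary (Fin (n + 1)) => graphShift G j η x, fun x hx => ?_,
    fun _ ⟨x, hx⟩ => ⟨x, hx⟩,
    hg _ (continuous_graphShift.comp continuous_subtype_val)
      ((graphShift_injective hG hj hG1 hη).comp Subtype.val_injective)⟩
  refine ⟨⟨Fin.cons 0 fun k => x (s k), 0, Or.inl (Fin.cons_zero _ _)⟩, ?_⟩
  exact (graphShift_cons_zero _).trans (hGK x hx)

lemma exists_superset_notMem (hg : MapsSpheresToCompacts n g) {s : Fin n → Fin m}
    (hs : Function.Injective s) {j : Fin m} (hj : ∀ k, s k ≠ j) {K : Set (Fin m → I)}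
    (hK : IsClosed K) (hinj : Set.InjOn (fun (x : Fin m → I) k => x (s k)) K)
    (hK1 : ∀ x ∈ K, (x j : ℝ) < 1) {z y : Fin m → I} (hy : y ∈ K) (hyz : ∀ k, y (s k) = z (s k))
    (hne : y ≠ z) : ∃ A, K ⊆ A ∧ z ∉ A ∧ IsCompact (g '' A) := by
  obtain ⟨G, hG, hG1, hGK⟩ := exists_section hs hj hK hinj hK1
  -- In the fibre of `z` the cell rises from `y` in direction `j`, by at most `η`. If `z` lies above
  -- `y`, half the gap is a small enough `η`; otherwise any `η` works, as the cell never goes below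
  -- `y`.
  have key : ∃ η : I, (0 : ℝ) < η ∧ z ∉ Set.range (graphShift G j η) := by
    have htail : ∀ (η : I) x, graphShift G j η x = z → G (Fin.tail x) = y := by
      rintro η x rfl
      rw [← graphShift_apply_section (η := η) hG hj x, ← hGK y hy]
      congr 1
      exact funext fun k => (hyz k).symm
    by_cases hlt : (y j : ℝ) < z j
    · have h1 := (y j).2.1
      have h2 := (z j).2.2
      refine ⟨⟨((z j : ℝ) - y j) / 2, by linarith, by linarith⟩, by
        change 0 < ((z j : ℝ) - y j) / 2
        linarith, ?_⟩
      rintro ⟨x, hx⟩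
      have h3 := coe_graphShift_apply (G := G) (j := j)
        (η := ⟨((z j : ℝ) - y j) / 2, by linarith, by linarith⟩) x
      rw [hx, htail _ _ hx] at h3
      have h4 := (x 0).2.1
      have h5 := (x 0).2.2
      have h6 := (y j).2.2
      have h7 : ((z j : ℝ) - y j) / 2 * x 0 ≤ ((z j : ℝ) - y j) / 2 :=
        mul_le_of_le_one_right (by linarith) h5
      have h8 : 0 ≤ ((z j : ℝ) - y j) / 2 * x 0 := mul_nonneg (by linarith) h4
      have h9 : (y j : ℝ) * (((z j : ℝ) - y j) / 2 * x 0) ≥ 0 := mul_nonneg h1 h8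
      nlinarith
    · refine ⟨1, zero_lt_one, ?_⟩
      rintro ⟨x, hx⟩
      refine hne (funext fun l => ?_)
      by_cases hl : l = j
      · subst hl
        have h3 := coe_graphShift_apply (G := G) (j := l) (η := 1) x
        rw [hx, htail _ _ hx] at h3
        have h4 := (x 0).2.1
        have h6 := sub_nonneg.2 (y l).2.2
        have h7 := mul_nonneg h6 h4
        refine Subtype.ext (le_antisymm ?_ (not_lt.1 hlt))
        rw [Set.Icc.coe_one, one_mul] at h3
        linarith
      · rw [← hx, graphShift_apply_of_ne x hl, htail _ _ hx]
  obtain ⟨η, hη, hz⟩ := key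
  obtain ⟨A, hKA, hA, hAc⟩ := exists_superset_isCompact_image hg hj hG hG1 hGK hη
  exact ⟨A, hKA, fun h => hz (hA h), hAc⟩

/-- Each point outside `K` is missed by some superset `A` of `K` with compact image. By injectivity
of `g`, the intersection of these closed images is `g '' K`. -/
lemma isClosed_image_of_injOn [T2Space Y] (hg : MapsSpheresToCompacts n g)
    (hg' : Function.Injective g) {s : Fin n → Fin m} (hs : Function.Injective s) {j : Fin m}
    (hj : ∀ k, s k ≠ j) {K : Set (Fin m → I)} (hK : IsClosed K)
    (hinj : Set.InjOn (fun (x : Fin m → I) k => x (s k)) K) (hK1 : ∀ x ∈ K, (x j : ℝ) < 1) :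
    IsClosed (g '' K) := by
  have hsep : ∀ z ∉ K, ∃ A, K ⊆ A ∧ z ∉ A ∧ IsCompact (g '' A) := by
    intro z hz
    by_cases h : ∃ y ∈ K, ∀ k, y (s k) = z (s k)
    · obtain ⟨y, hy, hyz⟩ := h
      exact exists_superset_notMem hg hs hj hK hinj hK1 hy hyz fun h => hz (h ▸ hy)
    -- If no point of `K` lies over the projection of `z`, one is added that differs from `z` in
    -- coordinate `j` only. This forces the section away from `z` and reduces to the previous case.
    · obtain ⟨a, ha1, ha⟩ : ∃ a : I, (a : ℝ) < 1 ∧ a ≠ z j := by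
        by_cases h0 : z j = 0
        · refine ⟨⟨1 / 2, by norm_num, by norm_num⟩, by norm_num, fun h => ?_⟩
          have := congrArg Subtype.val (h.trans h0)
          norm_num at this
        · exact ⟨0, zero_lt_one, fun h => h0 h.symm⟩
      have hw : ∀ k, Function.update z j a (s k) = z (s k) := fun k =>
        Function.update_of_ne (hj k) _ _
      have hinj' : Set.InjOn (fun (x : Fin m → I) k => x (s k)) ({Function.update z j a} ∪ K) := by
        rintro x (rfl | hx) y (rfl | hy) hxy
        · rfl
        · exact absurd ⟨y, hy, fun k => ((congrFun hxy k).symm.trans (hw k))⟩ h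
        · exact absurd ⟨x, hx, fun k => ((congrFun hxy k).trans (hw k))⟩ h
        · exact hinj hx hy hxy
      have hK1' : ∀ x ∈ {Function.update z j a} ∪ K, (x j : ℝ) < 1 := by
        rintro x (rfl | hx)
        · simpa using ha1
        · exact hK1 x hx
      have hne : Function.update z j a ≠ z := fun h' => by
        have := congrFun h' j
        rw [Function.update_self] at this
        exact ha this
      obtain ⟨A, hKA, hzA, hA⟩ := exists_superset_notMem hg hs hj (isClosed_singleton.union hK)
        hinj' hK1' (Or.inl rfl) hw hne
      exact ⟨A, Set.subset_union_right.trans hKA, hzA, hA⟩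
  obtain ⟨G, hG, hG1, hGK⟩ := exists_section hs hj hK hinj hK1
  obtain ⟨A, hKA, -, hA⟩ := exists_superset_isCompact_image hg hj hG hG1 hGK (η := 1) zero_lt_one
  refine isClosed_of_closure_subset fun y hy => ?_
  obtain ⟨z, -, rfl⟩ := closure_minimal (Set.image_mono hKA) hA.isClosed hy
  refine ⟨z, ?_, rfl⟩
  by_contra hz
  obtain ⟨B, hKB, hzB, hB⟩ := hsep z hz
  obtain ⟨z', hz', h⟩ := closure_minimal (Set.image_mono hKB) hB.isClosed hy
  exact hzB (hg' h ▸ hz')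

lemma exists_injective_avoiding (hn : n ≠ 0) (hm : n + 1 ≤ m) {i j : Fin m} (hij : i ≠ j) :
    ∃ s : Fin n → Fin m, Function.Injective s ∧ (∀ k, s k ≠ j) ∧ ∃ k, s k = i := by
  obtain ⟨u, hiu, huj, hu⟩ := Finset.exists_subsuperset_card_eq
    (s := {i}) (t := Finset.univ.erase j) (n := n) (by simpa using hij)
    (by rw [Finset.card_singleton]; exact Nat.one_le_iff_ne_zero.2 hn)
    (by rw [Finset.card_erase_of_mem (Finset.mem_univ j), Finset.card_univ, Fintype.card_fin]; omega)
  refine ⟨u.orderEmbOfFin hu, (u.orderEmbOfFin hu).injective, fun k hk => ?_, ?_⟩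
  · have := huj (u.orderEmbOfFin_mem hu k)
    rw [hk] at this
    simp at this
  · have : i ∈ Set.range (u.orderEmbOfFin hu) := by
      rw [Finset.range_orderEmbOfFin]
      exact hiu (Finset.mem_singleton_self i)
    exact this

/-- Coordinate `i` separates the points of each tail together with `a`, so late tails with `a` have
closed images, all containing `y`. If `y` were `g` of a term of the sequence, a tail starting past
that term would contradict injectivity. -/
lemma eq_of_tendsto_of_lt_one [T2Space Y] (hg : MapsSpheresToCompacts n g)
    (hg' : Function.Injective g) (hn : n ≠ 0) (hm : n + 1 ≤ m) {i j : Fin m} (hij : i ≠ j)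
    {x : ℕ → Fin m → I} {a : Fin m → I} (hx : Filter.Tendsto x Filter.atTop (nhds a))
    (hinj : Function.Injective fun k => x k i) (hne : ∀ k, x k i ≠ a i) (ha : (a j : ℝ) < 1)
    {y : Y} (hy : Filter.Tendsto (fun k => g (x k)) Filter.atTop (nhds y)) : y = g a := by
  obtain ⟨s, hs, hsj, k₀, hk₀⟩ := exists_injective_avoiding hn hm hij
  have hxj : Filter.Tendsto (fun k => (x k j : ℝ)) Filter.atTop (nhds (a j)) :=
    (continuous_subtype_val.tendsto _).comp (((continuous_apply j).tendsto a).comp hx)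
  obtain ⟨N, hN⟩ := Filter.eventually_atTop.1 (hxj.eventually_lt_const ha)
  have hmem : ∀ l ≥ N, y ∈ g '' insert a (Set.range fun k => x (k + l)) := by
    intro l hl
    have hxl : Filter.Tendsto (fun k => x (k + l)) Filter.atTop (nhds a) :=
      hx.comp (Filter.tendsto_add_atTop_nat l)
    have hcl := isClosed_image_of_injOn hg hg' hs hsj hxl.isCompact_insert_range.isClosed
      (by
        have hi : Set.InjOn (fun z : Fin m → I => z i) (insert a (Set.range fun k => x (k + l))) := by
          rintro _ (rfl | ⟨p, rfl⟩) _ (rfl | ⟨q, rfl⟩) h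
          · rfl
          · exact absurd h.symm (hne _)
          · exact absurd h (hne _)
          · exact congrArg x (hinj h)
        intro p hp q hq h
        exact hi hp hq (hk₀ ▸ congrFun h k₀))
      (by
        rintro _ (rfl | ⟨p, rfl⟩)
        · exact ha
        · exact hN _ (by omega))
    exact hcl.mem_of_tendsto (hy.comp (Filter.tendsto_add_atTop_nat l))
      (Filter.Eventually.of_forall fun k => ⟨_, Or.inr ⟨k, rfl⟩, rfl⟩)
  obtain ⟨z, hz, rfl⟩ := hmem N le_rfl
  rcases hz with rfl | ⟨p, rfl⟩
  · rfl
  · obtain ⟨z', hz', h⟩ := hmem (p + N + 1) (by omega)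
    obtain rfl := hg' h
    rcases hz' with h' | ⟨q, h'⟩
    · exact congrArg g h'
    · have := hinj (congrFun h' i)
      omega

/-- The reflection of a cube in a coordinate. -/
def flipCoord (j : Fin m) (x : Fin m → I) : Fin m → I :=
  Function.update x j (unitInterval.symm (x j))

lemma continuous_flipCoord (j : Fin m) : Continuous (flipCoord j) :=
  continuous_id.update j (unitInterval.continuous_symm.comp (continuous_apply j))

lemma flipCoord_flipCoord (j : Fin m) (x : Fin m → I) : flipCoord j (flipCoord j x) = x := by
  simp [flipCoord]

lemma MapsSpheresToCompacts.comp_flipCoord (hg : MapsSpheresToCompacts n g) (j : Fin m) :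
    MapsSpheresToCompacts n (g ∘ flipCoord j) := by
  intro Φ hΦ hΦ'
  have := hg (flipCoord j ∘ Φ) ((continuous_flipCoord j).comp hΦ)
    ((Function.LeftInverse.injective (flipCoord_flipCoord j)).comp hΦ')
  rwa [Set.range_comp, ← Set.image_comp] at this

lemma eq_of_tendsto [T2Space Y] (hg : MapsSpheresToCompacts n g)
    (hg' : Function.Injective g) (hn : n ≠ 0) (hm : n + 1 ≤ m) {i : Fin m}
    {x : ℕ → Fin m → I} {a : Fin m → I} (hx : Filter.Tendsto x Filter.atTop (nhds a))
    (hinj : Function.Injective fun k => x k i) (hne : ∀ k, x k i ≠ a i)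
    {y : Y} (hy : Filter.Tendsto (fun k => g (x k)) Filter.atTop (nhds y)) : y = g a := by
  have : Nontrivial (Fin m) := Fin.nontrivial_iff_two_le.2 (by omega)
  obtain ⟨j, hj⟩ := exists_ne i
  by_cases ha : (a j : ℝ) < 1
  · exact eq_of_tendsto_of_lt_one hg hg' hn hm hj.symm hx hinj hne ha hy
  -- Here `a j = 1`; reflecting coordinate `j` moves it to `0` without changing coordinate `i`.
  · have hfi : ∀ z : Fin m → I, flipCoord j z i = z i := fun z => Function.update_of_ne hj.symm _ _
    have h := eq_of_tendsto_of_lt_one (hg.comp_flipCoord j)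
      (hg'.comp (Function.LeftInverse.injective (flipCoord_flipCoord j))) hn hm hj.symm
      (((continuous_flipCoord j).tendsto a).comp hx)
      (by simpa only [Function.comp_apply, hfi] using hinj)
      (by simpa only [Function.comp_apply, hfi] using hne)
      (by
        have : (flipCoord j a j : ℝ) = 1 - a j := by simp [flipCoord]
        rw [this]
        linarith)
      (y := y) (by simpa only [Function.comp_apply, flipCoord_flipCoord] using hy)
    rwa [Function.comp_apply, flipCoord_flipCoord] at h

/-- An injective map of a cube of dimension at least `n + 1` which maps topological spheres of
dimension `n ≥ 1` onto compact sets is continuous. -/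
theorem MapsSpheresToCompacts.continuous [T2Space Y] [CompactSpace Y] [FirstCountableTopology Y]
    (hg : MapsSpheresToCompacts n g) (hg' : Function.Injective g) (hn : n ≠ 0) (hm : n + 1 ≤ m) :
    Continuous g := by
  have core : ∀ (x : ℕ → Fin m → I) (a : Fin m → I), Filter.Tendsto x Filter.atTop (nhds a) →
      ∃ φ : ℕ → ℕ, Filter.Tendsto (fun k => g (x (φ k))) Filter.atTop (nhds (g a)) := by
    intro x a hx
    by_cases hfr : ∃ᶠ k in Filter.atTop, x k = a
    · obtain ⟨φ, -, hφ⟩ := Filter.extraction_of_frequently_atTop hfr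
      exact ⟨φ, by simp only [hφ]; exact tendsto_const_nhds⟩
    obtain ⟨i, hi⟩ : ∃ i, ∃ᶠ k in Filter.atTop, x k i ≠ a i := by
      by_contra! h
      refine hfr (Filter.Eventually.frequently ?_)
      have : ∀ᶠ k in Filter.atTop, ∀ i, x k i = a i := Filter.eventually_all.2 fun i => by
        simpa using h i
      exact this.mono fun k hk => funext hk
    obtain ⟨φ₁, hφ₁, hne⟩ := Filter.extraction_of_frequently_atTop hi
    have hx₁ : Filter.Tendsto (fun k => x (φ₁ k)) Filter.atTop (nhds a) :=
      hx.comp hφ₁.tendsto_atTop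
    -- A subsequence along which these inverse distances strictly increase has pairwise distinct
    -- `i`-th coordinates.
    have hd : Filter.Tendsto (fun k => (dist (x (φ₁ k) i) (a i))⁻¹) Filter.atTop Filter.atTop := by
      refine Filter.Tendsto.inv_tendsto_nhdsGT_zero (tendsto_nhdsWithin_iff.2 ⟨?_, ?_⟩)
      · exact (tendsto_iff_dist_tendsto_zero).1 (((continuous_apply i).tendsto a).comp hx₁)
      · exact Filter.Eventually.of_forall fun k => dist_pos.2 (hne k)
    obtain ⟨φ₂, hφ₂, hmono⟩ := Filter.strictMono_subseq_of_tendsto_atTop hd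
    obtain ⟨y, -, φ₃, hφ₃, hy⟩ := isCompact_univ.tendsto_subseq
      (x := fun k => g (x (φ₁ (φ₂ k)))) fun _ => Set.mem_univ _
    refine ⟨fun k => φ₁ (φ₂ (φ₃ k)), ?_⟩
    have hya : y = g a := eq_of_tendsto hg hg' hn hm (i := i)
      (x := fun k => x (φ₁ (φ₂ (φ₃ k)))) (hx₁.comp (hφ₂.comp hφ₃).tendsto_atTop)
      (fun p q hpq => by
        refine hφ₃.injective (hmono.injective ?_)
        simp only [Function.comp_apply]
        rw [show x (φ₁ (φ₂ (φ₃ p))) i = x (φ₁ (φ₂ (φ₃ q))) i from hpq])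
      (fun k => hne _) hy
    exact hya ▸ hy
  refine continuous_iff_seqContinuous.2 fun x a hx => ?_
  refine Filter.tendsto_of_subseq_tendsto fun ns hns => ?_
  exact core (fun k => x (ns k)) a (hx.comp hns)

end MapsSpheres

/-! ### Affine simplices and the dimension of facets. -/

section AffineSimplex

variable {E : Type*} [NormedAddCommGroup E] [NormedSpace ℝ E]

lemma image_linearCombination_convexHull {m : ℕ} (v : Fin (m + 1) → E) (S : Set (Fin (m + 1))) :
    Fintype.linearCombination ℝ v '' convexHull ℝ ((fun i => Pi.single i 1) '' S) =
      convexHull ℝ (v '' S) := by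
  rw [LinearMap.image_convexHull, Set.image_image]
  simp

lemma injOn_linearCombination {m : ℕ} {v : Fin (m + 1) → E} (hv : AffineIndependent ℝ v) :
    Set.InjOn (Fintype.linearCombination ℝ v) (stdSimplex ℝ (Fin (m + 1))) := by
  intro x hx y hy hxy
  refine (affineIndependent_iff_eq_of_fintype_affineCombination_eq ℝ v).1 hv x y hx.2 hy.2 ?_
  rw [Finset.affineCombination_eq_linear_combination _ _ _ hx.2,
    Finset.affineCombination_eq_linear_combination _ _ _ hy.2]
  simpa [Fintype.linearCombination_apply] using hxy

lemma convexHull_range_eq {m : ℕ} (v : Fin (m + 1) → E) :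
    convexHull ℝ (Set.range v) = Fintype.linearCombination ℝ v '' stdSimplex ℝ (Fin (m + 1)) := by
  rw [← convexHull_rangle_single_eq_stdSimplex, ← Set.image_univ, ← Set.image_univ,
    image_linearCombination_convexHull]

lemma nonempty_stdSimplex_homeomorph_convexHull {m : ℕ} {v : Fin (m + 1) → E}
    (hv : AffineIndependent ℝ v) :
    Nonempty (stdSimplex ℝ (Fin (m + 1)) ≃ₜ convexHull ℝ (Set.range v)) := by
  have hmem : ∀ x : stdSimplex ℝ (Fin (m + 1)),
      Fintype.linearCombination ℝ v x.1 ∈ convexHull ℝ (Set.range v) := fun x => by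
    rw [convexHull_range_eq]
    exact ⟨x.1, x.2, rfl⟩
  let φ : stdSimplex ℝ (Fin (m + 1)) → convexHull ℝ (Set.range v) := fun x => ⟨_, hmem x⟩
  have hφ : Continuous φ := by
    refine Continuous.subtype_mk ?_ _
    simp only [Fintype.linearCombination_apply]
    refine continuous_finsetSum _ fun i _ => ?_
    exact ((continuous_apply i).comp continuous_subtype_val).smul continuous_const
  have hbij : Function.Bijective φ := by
    refine ⟨fun x y hxy => Subtype.ext
      (injOn_linearCombination hv x.2 y.2 (congrArg Subtype.val hxy)), fun y => ?_⟩
    obtain ⟨x, hx, hxy⟩ := (convexHull_range_eq v).subset y.2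
    exact ⟨⟨x, hx⟩, Subtype.ext hxy⟩
  exact ⟨Continuous.homeoOfEquivCompactToT2 (f := Equiv.ofBijective φ hbij) hφ⟩

/-- An affine simplex contains a point which does not belong to any proper face. -/
lemma exists_mem_convexHull_range_forall {m : ℕ} {v : Fin (m + 1) → E}
    (hv : AffineIndependent ℝ v) :
    ∃ b ∈ convexHull ℝ (Set.range v), ∀ S : Set (Fin (m + 1)),
      b ∈ convexHull ℝ (v '' S) → S = Set.univ := by
  let β : stdSimplex ℝ (Fin (m + 1)) := stdSimplex.barycenter
  refine ⟨Fintype.linearCombination ℝ v β.1, ?_, fun S hS => ?_⟩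
  · rw [convexHull_range_eq]
    exact ⟨_, β.2, rfl⟩
  · rw [← image_linearCombination_convexHull] at hS
    obtain ⟨x, hx, hxb⟩ := hS
    have hx' := AffineChain.convexHull_vertices_subset m S hx
    have hxβ : x = β.1 := injOn_linearCombination hv hx'.1 β.2 hxb
    refine Set.eq_univ_of_forall fun j => ?_
    by_contra hj
    have h0 := hx'.2 j hj
    rw [hxβ] at h0
    have : ((m + 1 : ℕ) : ℝ)⁻¹ = 0 := by
      simpa [β, stdSimplex.barycenter] using h0
    exact absurd this (by positivity)

lemma exists_affineIndependent_range_eq {K : Geometry.SimplicialComplex ℝ E} {s : Finset E}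
    (hs : s ∈ K.faces) :
    ∃ (m : ℕ) (v : Fin (m + 1) → E), AffineIndependent ℝ v ∧ Set.range v = s := by
  obtain ⟨m, hm⟩ := Nat.exists_eq_succ_of_ne_zero
    (Finset.card_ne_zero.2 (K.nonempty_of_mem_faces hs))
  let ε := (s.equivFinOfCardEq hm).symm
  refine ⟨m, fun i => ε i, (K.indep hs).comp_embedding ε.toEmbedding, ?_⟩
  ext x
  exact ⟨fun ⟨i, hi⟩ => hi ▸ (ε i).2, fun hx => ⟨ε.symm ⟨x, hx⟩, by simp⟩⟩

end AffineSimplex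

lemma Geometry.SimplicialComplex.isCompact_space {d : ℕ}
    {K : Geometry.SimplicialComplex ℝ (EuclideanSpace ℝ (Fin d))} (hK : K.faces.Finite) :
    IsCompact K.space :=
  hK.isCompact_biUnion fun s _ => s.finite_toSet.isCompact_convexHull ℝ

/-- A point of a topological simplex has arbitrarily small neighbourhoods containing a topological
simplex of the same dimension. -/
lemma IsTopologicalSimplex.exists_injective {X : Type*} [TopologicalSpace X] {k : ℕ} {D : Set X}
    (hD : IsTopologicalSimplex k D) {x : X} (hx : x ∈ D) {U : Set X} (hU : IsOpen U)
    (hxU : x ∈ U) :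
    ∃ c : stdSimplex ℝ (Fin (k + 1)) → X, Continuous c ∧ Function.Injective c ∧ ∀ y, c y ∈ U := by
  obtain ⟨h⟩ := hD
  set p := h ⟨x, hx⟩
  have hV : IsOpen {y | (h.symm y : X) ∈ U} :=
    hU.preimage (continuous_subtype_val.comp h.symm.continuous)
  have hp : p ∈ {y | (h.symm y : X) ∈ U} := by
    change ((h.symm (h ⟨x, hx⟩) : D) : X) ∈ U
    rwa [h.symm_apply_apply]
  obtain ⟨δ, hδ, hball⟩ := Metric.isOpen_iff.1 hV p hp
  -- Ratio of a homothety centred at `p`: below `1`, so it preserves the simplex, and below `δ`, so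
  -- the image fits in the ball, the simplex having diameter at most `1`.
  set ε : ℝ := δ / (1 + δ)
  have hε0 : 0 < ε := by positivity
  have hε1 : ε ≤ 1 := (div_le_one (by positivity)).2 (by linarith)
  have hεδ : ε < δ := by
    rw [div_lt_iff₀ (by positivity)]
    nlinarith
  let c : stdSimplex ℝ (Fin (k + 1)) → stdSimplex ℝ (Fin (k + 1)) := fun y =>
    ⟨(1 - ε) • p.1 + ε • y.1, convex_stdSimplex ℝ _ p.2 y.2 (by linarith) hε0.le (by ring)⟩
  have hc : Continuous c := by
    refine Continuous.subtype_mk ?_ _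
    exact continuous_const.add (continuous_subtype_val.const_smul ε)
  have hcinj : Function.Injective c := fun y z hyz => by
    have := congrArg Subtype.val hyz
    simp only [c, add_right_inj] at this
    exact Subtype.ext (smul_right_injective _ hε0.ne' this)
  refine ⟨fun y => h.symm (c y), continuous_subtype_val.comp (h.symm.continuous.comp hc),
    Subtype.val_injective.comp (h.symm.injective.comp hcinj), fun y => hball ?_⟩
  rw [Metric.mem_ball, Subtype.dist_eq, dist_eq_norm]
  have h1 : (c y).1 - p.1 = ε • (y.1 - p.1) := by
    simp only [c]
    module
  rw [h1, norm_smul, Real.norm_of_nonneg hε0.le, ← dist_eq_norm]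
  have h2 : dist y.1 p.1 ≤ 1 :=
    (Metric.dist_le_diam_of_mem (bounded_stdSimplex _) y.2 p.2).trans diam_stdSimplex_le
  nlinarith

/-- The dimension of a facet of a triangulation is not less than the dimension of the topological
simplices that cover the space. -/
lemma le_of_mem_facets {X : Type*} [TopologicalSpace X] {d k : ℕ}
    {K : Geometry.SimplicialComplex ℝ (EuclideanSpace ℝ (Fin d))} (hK : K.faces.Finite)
    (ψ : X ≃ₜ K.space) (hX : ∀ x : X, ∃ D : Set X, x ∈ D ∧ IsTopologicalSimplex k D)
    {s : Finset (EuclideanSpace ℝ (Fin d))} (hs : s ∈ K.facets) {m : ℕ}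
    {v : Fin (m + 1) → EuclideanSpace ℝ (Fin d)} (hv : AffineIndependent ℝ v)
    (hvs : Set.range v = s) : k ≤ m := by
  obtain ⟨b, hb, hbS⟩ := exists_mem_convexHull_range_forall hv
  rw [hvs] at hb
  let x : X := ψ.symm ⟨b, K.convexHull_subset_space hs.1 hb⟩
  have hψx : (ψ x : EuclideanSpace ℝ (Fin d)) = b := by simp [x]
  -- Discarding the closed simplices of `T` leaves an open set around `x`. It lies in the simplex of
  -- `s`, since by maximality the only face containing `s` is `s`.
  let T : Set (Finset (EuclideanSpace ℝ (Fin d))) := {t ∈ K.faces | ¬ s ⊆ t}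
  let U : Set X := (⋃ t ∈ T, {y | (ψ y : EuclideanSpace ℝ (Fin d)) ∈ convexHull ℝ (t : Set _)})ᶜ
  have hU : IsOpen U := by
    refine ((hK.subset (Set.sep_subset _ _)).isClosed_biUnion fun t _ => ?_).isOpen_compl
    exact (t.finite_toSet.isCompact_convexHull ℝ).isClosed.preimage
      (continuous_subtype_val.comp ψ.continuous)
  have hxU : x ∈ U := by
    simp only [U, Set.mem_compl_iff, Set.mem_iUnion, not_exists]
    rintro t ⟨ht, hst⟩ hxt
    have hbt : b ∈ convexHull ℝ (t : Set (EuclideanSpace ℝ (Fin d))) := hψx ▸ hxt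
    have hb' := K.inter_subset_convexHull hs.1 ht ⟨hb, hbt⟩
    have himg : (s : Set (EuclideanSpace ℝ (Fin d))) ∩ t = v '' {i | v i ∈ t} := by
      rw [← hvs]
      ext y
      constructor
      · rintro ⟨⟨i, rfl⟩, hy⟩
        exact ⟨i, hy, rfl⟩
      · rintro ⟨i, hi, rfl⟩
        exact ⟨⟨i, rfl⟩, hi⟩
    rw [himg] at hb'
    have huniv := hbS _ hb'
    refine hst fun y hy => ?_
    obtain ⟨i, rfl⟩ := hvs.symm.subset hy
    exact huniv.symm.subset (Set.mem_univ i)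
  have hUs : ∀ y ∈ U, (ψ y : EuclideanSpace ℝ (Fin d)) ∈ convexHull ℝ (Set.range v) := by
    intro y hy
    obtain ⟨t, ht, hyt⟩ := K.mem_space_iff.1 (ψ y).2
    have hst : s ⊆ t := by
      by_contra hst
      exact hy (Set.mem_biUnion (x := t) ⟨ht, hst⟩ hyt)
    rw [hvs, hs.2 ht hst]
    exact hyt
  obtain ⟨D, hxD, hD⟩ := hX x
  obtain ⟨c, hc, hcinj, hcU⟩ := hD.exists_injective hxD hU hxU
  obtain ⟨e⟩ := nonempty_stdSimplex_homeomorph_convexHull hv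
  let q : stdSimplex ℝ (Fin (k + 1)) → Fin m → ℝ := fun y =>
    (stdSimplexHomeomorphCorner m (e.symm ⟨ψ (c y), hUs _ (hcU y)⟩)).1
  have hq : Continuous q := by
    refine continuous_subtype_val.comp ((stdSimplexHomeomorphCorner m).continuous.comp
      (e.symm.continuous.comp (Continuous.subtype_mk ?_ _)))
    exact continuous_subtype_val.comp (ψ.continuous.comp hc)
  have hqinj : Function.Injective q := fun y z hyz => by
    have h1 := e.symm.injective ((stdSimplexHomeomorphCorner m).injective (Subtype.ext hyz))
    have h2 : (ψ (c y) : EuclideanSpace ℝ (Fin d)) = ψ (c z) :=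
      congrArg (fun u : convexHull ℝ (Set.range v) => (u : EuclideanSpace ℝ (Fin d))) h1
    exact hcinj (ψ.injective (Subtype.ext h2))
  simpa using stdSimplex.le_finrank_of_injective hq hqinj

/-! ### Proof of the theorem. -/

/-- The composition of a hereditary equivalence with the embedding of a cube maps topological
spheres onto compact sets. -/
lemma IsHereditaryEquivalence.mapsSpheresToCompacts {X Y : Type u} [TopologicalSpace X]
    [T2Space X] [TopologicalSpace Y] {n : ℕ} (hn : n ≠ 0) {f : X → Y}
    (hf : IsHereditaryEquivalence (singularHomologyInt.{u} n) f) {m : ℕ} {e : (Fin m → I) → X}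
    (he : Continuous e) (he' : Function.Injective e) : MapsSpheresToCompacts n (f ∘ e) := by
  intro Φ hΦ hΦ'
  obtain ⟨e₂⟩ := nonempty_cubeBoundary_homeomorph_sphere (n + 1)
  have : CompactSpace (Cube.boundary (Fin (n + 1))) := e₂.symm.compactSpace
  have h := ((he.comp hΦ).isClosedEmbedding (he'.comp hΦ')).isEmbedding.toHomeomorph
  have := hf.isCompact_image_sphere hn h.symm
  rwa [Set.range_comp, ← Set.image_comp] at this

theorem mainTheorem3 {X Y : Type u} [TopologicalSpace X] [TopologicalSpace Y]
    (hX : IsFinitePolyhedron X) (hY : IsFinitePolyhedron Y) (n : ℕ) (hn : 1 ≤ n)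
    (hsimplex : ∀ x : X, ∃ D : Set X, x ∈ D ∧ IsTopologicalSimplex (n + 1) D)
    (f : X → Y) (hf : IsHereditaryEquivalence (singularHomologyInt.{u} n) f) :
    IsHomeomorph f := by
  obtain ⟨d, K, hK, ⟨ψ⟩⟩ := hX
  obtain ⟨d', K', hK', ⟨ψ'⟩⟩ := hY
  have hn0 : n ≠ 0 := Nat.one_le_iff_ne_zero.1 hn
  have hXs : CompactSpace K.space := isCompact_iff_compactSpace.1 (K.isCompact_space hK)
  have hYs : CompactSpace K'.space := isCompact_iff_compactSpace.1 (K'.isCompact_space hK')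
  have : CompactSpace X := ψ.symm.compactSpace
  have : CompactSpace Y := ψ'.symm.compactSpace
  have : T2Space X := ψ.symm.t2Space
  have : T2Space Y := ψ'.symm.t2Space
  have : FirstCountableTopology Y := ψ'.isInducing.firstCountableTopology
  rw [isHomeomorph_iff_continuous_bijective]
  refine ⟨continuous_iff_isClosed.2 fun C hC => ?_, hf.1⟩
  -- A facet is an embedded cube of dimension `m ≥ n + 1`, on which `f` is continuous. The part of
  -- the preimage in it is thus the image of a compact subset of the cube.
  have hclosed : ∀ s ∈ K.facets, IsClosed
      (f ⁻¹' C ∩ {x | (ψ x : EuclideanSpace ℝ (Fin d)) ∈ convexHull ℝ (s : Set _)}) := by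
    intro s hs
    obtain ⟨m, v, hv, hvs⟩ := exists_affineIndependent_range_eq hs.1
    have hm := le_of_mem_facets hK ψ hsimplex hs hv hvs
    obtain ⟨e₁⟩ := nonempty_cube_homeomorph_stdSimplex m
    obtain ⟨e₂⟩ := nonempty_stdSimplex_homeomorph_convexHull hv
    have hsub : convexHull ℝ (Set.range v) ⊆ K.space := hvs ▸ K.convexHull_subset_space hs.1
    let e : (Fin m → I) → X := fun z => ψ.symm ⟨e₂ (e₁ z), hsub (e₂ (e₁ z)).2⟩
    have he : Continuous e := by
      refine ψ.symm.continuous.comp (Continuous.subtype_mk ?_ _)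
      exact continuous_subtype_val.comp (e₂.continuous.comp e₁.continuous)
    have he' : Function.Injective e := fun a b hab => by
      have h : (e₂ (e₁ a) : EuclideanSpace ℝ (Fin d)) = e₂ (e₁ b) :=
        congrArg (fun u : K.space => (u : EuclideanSpace ℝ (Fin d))) (ψ.symm.injective hab)
      exact e₁.injective (e₂.injective (Subtype.ext h))
    have hg := (hf.mapsSpheresToCompacts hn0 he he').continuous (hf.1.1.comp he') hn0 hm
    have heq : f ⁻¹' C ∩ {x | (ψ x : EuclideanSpace ℝ (Fin d)) ∈ convexHull ℝ (s : Set _)} =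
        e '' ((f ∘ e) ⁻¹' C) := by
      ext x
      constructor
      · rintro ⟨hxC, hxs⟩
        rw [← hvs] at hxs
        have hx : e (e₁.symm (e₂.symm ⟨_, hxs⟩)) = x := by simp [e]
        exact ⟨_, by rwa [Set.mem_preimage, Function.comp_apply, hx], hx⟩
      · rintro ⟨z, hz, rfl⟩
        refine ⟨hz, ?_⟩
        rw [← hvs]
        simp [e]
    rw [heq]
    exact ((hC.preimage hg).isCompact.image he).isClosed
  have hunion : f ⁻¹' C = ⋃ s ∈ K.facets,
      (f ⁻¹' C ∩ {x | (ψ x : EuclideanSpace ℝ (Fin d)) ∈ convexHull ℝ (s : Set _)}) := by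
    ext x
    simp only [Set.mem_iUnion]
    refine ⟨fun hx => ?_, fun ⟨s, _, hx⟩ => hx.1⟩
    obtain ⟨t, ht, hxt⟩ := K.mem_space_iff.1 (ψ x).2
    obtain ⟨s, hts, hs⟩ := hK.exists_le_maximal ht
    exact ⟨s, ⟨hs.1, fun r hr hsr => hsr.antisymm (hs.2 hr hsr)⟩, hx, convexHull_mono hts hxt⟩
  rw [hunion]
  exact (hK.subset K.facets_subset).isClosed_biUnion hclosed
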